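/- **Setting.** Fix $\hbar\in(0,1]$ and a sequence $(q_j)_{j\ge 1}$ of positive reals with $\sum_j q_j^2<\infty$. For a function $f\colon\mathbb R^n\to\mathbb C$ and a window $g$ put $$V_gf(x,\xi)=(2\pi\hbar)^{-n/2}\int_{\mathbb R^n}e^{-\frac i\hbar \xi\cdot y}f(y)\overline{g(y-x)}\,dy,\qquad \|f\|_{M^{\infty,1}_{(g)}(\mathbb R^n)}=\int_{\mathbb R^n}\sup_{x\in\mathbb R^n}|V_gf(x,\xi)|\,d\xi .$$ The Sjöstrand class $M^{\infty,1}(\mathbb R^n)$ consists of the continuous functions $f$ on $\mathbb R^n$ which define a temperate distribution (that is, $f\varphi$ is integrable for every $\varphi\in\mathcal S(\mathbb R^n)$) and satisfy $\|f\|_{M^{\infty,1}_{(g)}}<\infty$ for some $g\in\mathcal S(\mathbb R^n)\setminus\{0\}$. A function $f$ on $\mathbb R^n$ is Fresnel integrable, with Fresnel integral $a\in\mathbb C$, if for every $\varphi\in\mathcal S(\mathbb R^n)$ with $\varphi(0)=1$ $$\lim_{\varepsilon\downarrow0}(2\pi i\hbar)^{-n/2}\int_{\mathbb R^n}e^{\frac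 i{2\hbar}|x|^2}f(x)\varphi(\varepsilon x)\,dx=a .$$ For $f\in M^{\infty,1}(\mathbb R^n)$ let $L_n(f)$ be its Fresnel integral. Let $\mathbb R^\infty=\mathbb R^{\mathbb N}$, let $\pi_n\colon\mathbb R^\infty\to\mathbb R^n$ be the projection to the first $n$ coordinates, $\mathcal E_nF=F\circ\pi_n$, and let $\mathcal C_0=\bigcup_n\mathcal E_nM^{\infty,1}(\mathbb R^n)$ be the set of cylinder functions. With the Gaussian windows $g_n(x)=(2\pi\hbar)^{-n/2}\exp\big(-\frac1{2\hbar}\sum_{j=1}^nq_jx_j^2\big)$ set, for $f=\mathcal E_nF$ with $F\in M^{\infty,1}(\mathbb R^n)$, $$\|f\|=\|F\|_{M^{\infty,1}_{(g_n)}(\mathbb R^n)},\qquad L_{\min}(f)=L_n(F)$$ (neither depends on the representation of $f$). Let $(L,D(L))$ be the closure of $L_{\min}$ in this norm, realized on functions: $D(L)$ is the set of the functions $f\colon\mathbb R^\infty\to\mathbb C$ for which there is a sequence $(c_j)$ in $\mathcal C_0$, Cauchy for $\|\cdot\|$, with $c_j(x)\to f(x)$ for every $x\in\mathbb R^\infty$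 (we say that $(c_j)$ represents $f$), and $L(f)=\lim_jL_{\min}(c_j)$. For $f\colon\mathbb R^\infty\to\mathbb C$ let $f^{(n)}(x_1,\dots,x_n)=f(x_1,\dots,x_n,0,0,\dots)$. Let $D(L')$ be the set of all $f\colon\mathbb R^\infty\to\mathbb C$ such that $f^{(n)}\in M^{\infty,1}(\mathbb R^n)$ for every $n$ and $\lim_nL_n(f^{(n)})$ exists in $\mathbb C$, and for such $f$ let $L'(f)=\lim_nL_n(f^{(n)})$. **Theorem.** Every Cauchy sequence in $\mathcal C_0$ converges pointwise on $\mathbb R^\infty$, hence represents a function in $D(L)$. The functional $L'$ extends $L$: for every $f\in D(L)$, $$f\in D(L')\qquad\text{and}\qquad L'(f)=L(f).$$ Here every $f^{(n)}$ is Fresnel integrable with Fresnel integral $L_n(f^{(n)})$, and $L_{\min}(c_j)\to L(f)$ for every Cauchy sequence $(c_j)$ in $\mathcal C_0$ that represents $f$. -/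

import Mathlib

open MeasureTheory Filter Topology
open scoped ENNReal SchwartzMap

noncomputable section

namespace Fresnel

/-- `ℝⁿ` with its Euclidean structure and Lebesgue measure. -/
abbrev Rn (n : ℕ) : Type := EuclideanSpace ℝ (Fin n)

/-- The space `ℝ^∞` of all real sequences `(x₁, x₂, …)`; `x j` is the entry `x_{j+1}`. -/
abbrev RInf : Type := ℕ → ℝ

/-- The Gabor (short-time Fourier) transform with parameter `hbar`,
`V_g f (x, ξ) = (2πħ)^{-n/2} ∫ e^{-(i/ħ) ξ·y} f(y) \overline{g(y - x)} dy`. -/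
def stft (hbar : ℝ) {n : ℕ} (g f : Rn n → ℂ) (x ξ : Rn n) : ℂ :=
  (((2 * Real.pi * hbar) ^ (-(n : ℝ) / 2) : ℝ) : ℂ) *
    ∫ y : Rn n, Complex.exp (-(Complex.I / (hbar : ℂ)) * ((inner ℝ ξ y : ℝ) : ℂ)) * f y *
      (starRingEnd ℂ) (g (y - x))

/-- The (extended) norm `∫ sup_x |V_g f (x, ξ)| dξ` of the Sjöstrand class, with window `g`. -/
def sjNorm (hbar : ℝ) {n : ℕ} (g f : Rn n → ℂ) : ℝ≥0∞ :=
  ∫⁻ ξ : Rn n, ⨆ x : Rn n, ‖stft hbar g f x ξ‖ₑ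

/-- The Sjöstrand class `M^{∞,1}(ℝⁿ)`. Its elements are temperate distributions that are given
by continuous functions, and they are identified with these functions: `f` is continuous, it is
a temperate distribution (it can be integrated against every Schwartz function), and its norm
with respect to some nonzero Schwartz window is finite. -/
def sjostrand (hbar : ℝ) (n : ℕ) : Set (Rn n → ℂ) :=
  {f | Continuous f ∧ (∀ φ : 𝓢(Rn n, ℂ), Integrable (fun x => f x * φ x)) ∧
    ∃ g : 𝓢(Rn n, ℂ), g ≠ 0 ∧ sjNorm hbar (g : Rn n → ℂ) f < ∞}

/-- `f` is Fresnel integrable on `ℝⁿ` with Fresnel integral `a`: for every Schwartz function `φ`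
with `φ(0) = 1`, the regularized integrals
`(2πiħ)^{-n/2} ∫ e^{(i/2ħ)|x|²} f(x) φ(εx) dx` tend to `a` as `ε ↓ 0`. -/
def HasFresnelIntegral (hbar : ℝ) {n : ℕ} (f : Rn n → ℂ) (a : ℂ) : Prop :=
  ∀ φ : 𝓢(Rn n, ℂ), φ 0 = 1 →
    Tendsto (fun ε : ℝ =>
        (2 * (Real.pi : ℂ) * Complex.I * (hbar : ℂ)) ^ (-(n : ℂ) / 2) *
          ∫ x : Rn n, Complex.exp (Complex.I / (2 * (hbar : ℂ)) * ((‖x‖ ^ 2 : ℝ) : ℂ)) * f x *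
            φ (ε • x))
      (𝓝[>] 0) (𝓝 a)

open Classical in
/-- The functional `L_n`: the Fresnel integral of `f` over `ℝⁿ` (and `0` if there is none). -/
def Ln (hbar : ℝ) {n : ℕ} (f : Rn n → ℂ) : ℂ :=
  if h : ∃ a, HasFresnelIntegral hbar f a then h.choose else 0

/-- The projection `π_n : ℝ^∞ → ℝⁿ` to the first `n` coordinates. -/
def proj (n : ℕ) (x : RInf) : Rn n := WithLp.toLp 2 (fun i : Fin n => x i)

/-- The cylinder function `ℰ_n F = F ∘ π_n` on `ℝ^∞`. -/
def extend {n : ℕ} (F : Rn n → ℂ) : RInf → ℂ := fun x => F (proj n x)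

/-- The restriction `f^{(n)}(x₁, …, x_n) = f(x₁, …, x_n, 0, 0, …)`. -/
def restrict (n : ℕ) (f : RInf → ℂ) : Rn n → ℂ :=
  fun x => f (fun j => if h : j < n then x ⟨j, h⟩ else 0)

/-- The Gaussian window `g_n(x) = (2πħ)^{-n/2} exp(-(1/2ħ) ∑_{j ≤ n} q_j x_j²)`. -/
def window (hbar : ℝ) (q : ℕ → ℝ) (n : ℕ) : Rn n → ℂ :=
  fun x => (((2 * Real.pi * hbar) ^ (-(n : ℝ) / 2) *
    Real.exp (-(1 / (2 * hbar)) * ∑ j : Fin n, q j * x j ^ 2) : ℝ) : ℂ)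

/-- The space `𝒞₀ = ⋃_n ℰ_n M^{∞,1}(ℝⁿ)` of cylinder functions. -/
def cylinder (hbar : ℝ) : Set (RInf → ℂ) :=
  {f | ∃ (n : ℕ) (F : Rn n → ℂ), F ∈ sjostrand hbar n ∧ f = extend F}

/-- The norm of a cylinder function `f = ℰ_n F`, `F ∈ M^{∞,1}(ℝⁿ)`: it is the norm of `F` with
the window `g_n`. This number is the same for all representations `(n, F)` of `f`, so that the
infimum is over a constant family. -/
def cylNorm (hbar : ℝ) (q : ℕ → ℝ) (f : RInf → ℂ) : ℝ≥0∞ :=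
  ⨅ (n : ℕ) (F : Rn n → ℂ) (_ : F ∈ sjostrand hbar n ∧ f = extend F),
    sjNorm hbar (window hbar q n) F

open Classical in
/-- The minimal extension `L_min(f) = L_n(F)` for `f = ℰ_n F`, `F ∈ M^{∞,1}(ℝⁿ)`, on `𝒞₀`. -/
def Lmin (hbar : ℝ) (f : RInf → ℂ) : ℂ :=
  if h : ∃ p : (n : ℕ) × (Rn n → ℂ), p.2 ∈ sjostrand hbar p.1 ∧ f = extend p.2 then
    Ln hbar h.choose.2
  else 0

/-- `c` is a Cauchy sequence of cylinder functions. -/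
def IsCauchyCyl (hbar : ℝ) (q : ℕ → ℝ) (c : ℕ → RInf → ℂ) : Prop :=
  (∀ j, c j ∈ cylinder hbar) ∧
    ∀ ε : ℝ≥0∞, 0 < ε → ∃ N : ℕ, ∀ j ≥ N, ∀ k ≥ N, cylNorm hbar q (c j - c k) < ε

/-- The Cauchy sequence `c` of cylinder functions represents the function `f`, its pointwise
limit. -/
def Represents (hbar : ℝ) (q : ℕ → ℝ) (c : ℕ → RInf → ℂ) (f : RInf → ℂ) : Prop :=
  IsCauchyCyl hbar q c ∧ ∀ x : RInf, Tendsto (fun j => c j x) atTop (𝓝 (f x))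

/-- The domain `D(L)`, the closure of `𝒞₀`, realized as a set of functions on `ℝ^∞`. -/
def domL (hbar : ℝ) (q : ℕ → ℝ) : Set (RInf → ℂ) :=
  {f | ∃ c, Represents hbar q c f}

open Classical in
/-- The closure `L` of `L_min`: `L(f) = lim_j L_min(c_j)` for a Cauchy sequence `c` of cylinder
functions that represents `f`. -/
def L (hbar : ℝ) (q : ℕ → ℝ) (f : RInf → ℂ) : ℂ :=
  if h : ∃ c, Represents hbar q c f then
    limUnder atTop (fun j => Lmin hbar (h.choose j))
  else 0

/-- The domain `D(L')`: all restrictions `f^{(n)}` are in `M^{∞,1}(ℝⁿ)`, and the limit of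
`L_n(f^{(n)})` exists. -/
def domL' (hbar : ℝ) : Set (RInf → ℂ) :=
  {f | (∀ n, restrict n f ∈ sjostrand hbar n) ∧
    ∃ a : ℂ, Tendsto (fun n => Ln hbar (restrict n f)) atTop (𝓝 a)}

/-- The sequential functional `L'(f) = lim_n L_n(f^{(n)})`. -/
def L' (hbar : ℝ) (f : RInf → ℂ) : ℂ :=
  limUnder atTop (fun n => Ln hbar (restrict n f))

end Fresnel

end

/-! The theorem is an interchange of two limits, justified by estimates for the Gaussian windows
whose constants do not depend on the dimension.

Continuity of the functionals (`exists_hasFresnelIntegral`, `enorm_Ln_le`). Insert the window into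
the regularized Fresnel integral and complete the square in the phase. Up to the factor A = ∫
exp(-i|t|²/2ħ) conj(g_n(t)) dt, the integral becomes one of exp(-i|x|²/2ħ) times the Gabor transform
at (x, -x). Taking the supremum over positions and integrating over frequencies dominates this by
the norm, also uniformly in the regularization. For the Gaussian window |A|⁻¹ = ∏ (1 + q_j²)^{1/4},
and square-summability of q bounds this product for all n at once.

Comparison of dimensions. Fourier inversion and the value g_n(0) = (2πħ)^{-n/2} show that the norm
dominates the supremum norm with constant one (`enorm_le_sjNorm_window`). Inversion in one variable
shows that setting a variable to zero does not increase the norm (`sjNorm_snoc_zero_le`); the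
normalization of the one-dimensional factor gives the same for a dummy variable
(`sjNorm_comp_init_le`). Hence the norm of a cylinder function bounds the norms of all its
restrictions. That arbitrary Schwartz windows define the same class (`sjNorm_lt_top_of_window`)
permits working with Gaussian windows throughout.

Conclusion. A Cauchy sequence c_j converges uniformly to some f. By Fatou's lemma the restrictions
of c_j converge to those of f in norm, uniformly in n (`Represents.sjNorm_sub_le`), so
L_n(c_j^{(n)}) → L_n(f^{(n)}) uniformly in n. For fixed j the numbers L_n(c_j^{(n)}) are eventually
equal to L_min(c_j). The two iterated limits therefore exist and agree
(`Represents.exists_tendsto`). -/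

noncomputable section

namespace Fresnel

/-! ### Gaussians as Schwartz functions -/

section Gaussian

variable {E : Type*} [NormedAddCommGroup E] [InnerProductSpace ℝ E]

lemma norm_iteratedFDeriv_id_le (i : ℕ) (x : E) :
    ‖iteratedFDeriv ℝ i (fun y : E => y) x‖ ≤ 1 + ‖x‖ := by
  rcases i with _ | _ | i
  · simp
  · rw [norm_iteratedFDeriv_one]
    have : fderiv ℝ (fun y : E => y) x = ContinuousLinearMap.id ℝ E := fderiv_fun_id
    rw [this]
    exact ContinuousLinearMap.norm_id_le.trans (by simp)
  · rw [← norm_iteratedFDeriv_fderiv]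
    have : fderiv ℝ (fun y : E => y) = fun _ => ContinuousLinearMap.id ℝ E := by
      ext1 x; exact fderiv_fun_id
    rw [this, iteratedFDeriv_succ_const]
    simp; positivity

/-- The bound has the form D ^ i because the Faà di Bruno estimate `norm_iteratedFDeriv_comp_le`
asks for it; the Gaussian is exp composed with this function. -/
lemma norm_iteratedFDeriv_normSq_le (i : ℕ) (hi : 1 ≤ i) (x : E) :
    ‖iteratedFDeriv ℝ i (fun y : E => -‖y‖ ^ 2) x‖ ≤ (2 * (1 + ‖x‖) ^ 2) ^ i := by
  have h1 : (fun y : E => -‖y‖ ^ 2) = -(fun y : E => innerSL ℝ y y) := by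
    ext y; simp
  rw [h1, iteratedFDeriv_neg, Pi.neg_apply, norm_neg]
  have h2 := (innerSL ℝ (E := E)).norm_iteratedFDeriv_le_of_bilinear_of_le_one
    (f := fun y : E => y) (g := fun y : E => y) (N := (i : WithTop ℕ∞)) contDiff_id contDiff_id x
    le_rfl (norm_innerSL_le ℝ)
  refine h2.trans ?_
  have h3 : ∑ j ∈ Finset.range (i + 1), (i.choose j : ℝ) *
      ‖iteratedFDeriv ℝ j (fun y : E => y) x‖ * ‖iteratedFDeriv ℝ (i - j) (fun y : E => y) x‖
      ≤ ∑ j ∈ Finset.range (i + 1), (i.choose j : ℝ) * (1 + ‖x‖) ^ 2 := by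
    refine Finset.sum_le_sum fun j _ => ?_
    rw [mul_assoc, pow_two]
    gcongr <;> exact norm_iteratedFDeriv_id_le _ _
  refine h3.trans ?_
  rw [← Finset.sum_mul, mul_pow]
  have h4 : ∑ j ∈ Finset.range (i + 1), (i.choose j : ℝ) = 2 ^ i := by
    exact_mod_cast Nat.sum_range_choose i
  rw [h4]
  gcongr
  exact le_self_pow₀ (one_le_pow₀ (by simp)) (by omega)

lemma exists_pow_mul_exp_neg_sq_le (K : ℕ) : ∃ C : ℝ, ∀ r : ℝ, 0 ≤ r →
    (1 + r) ^ K * Real.exp (-r ^ 2) ≤ C := by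
  refine ⟨K.factorial * Real.exp 2, fun r hr => ?_⟩
  have h1 : (1 + r) ^ K / K.factorial ≤ Real.exp (1 + r) :=
    Real.pow_div_factorial_le_exp _ (by positivity) _
  have hK : (0 : ℝ) < K.factorial := by positivity
  rw [div_le_iff₀ hK] at h1
  calc (1 + r) ^ K * Real.exp (-r ^ 2) ≤ Real.exp (1 + r) * K.factorial * Real.exp (-r ^ 2) := by
        gcongr
    _ = K.factorial * Real.exp (1 + r + -r ^ 2) := by
        rw [Real.exp_add (1 + r)]; ring
    _ ≤ _ := by
        gcongr
        nlinarith [sq_nonneg (r - 1 / 2)]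

/-- The standard Gaussian as a Schwartz function. -/
def stdGaussian (E : Type*) [NormedAddCommGroup E] [InnerProductSpace ℝ E] : 𝓢(E, ℝ) where
  toFun x := Real.exp (-‖x‖ ^ 2)
  smooth' := (Real.contDiff_exp.comp ((contDiff_norm_sq ℝ).neg))
  decay' k n := by
    obtain ⟨C, hC⟩ := exists_pow_mul_exp_neg_sq_le (k + 2 * n)
    refine ⟨n.factorial * 2 ^ n * C, fun x => ?_⟩
    have h := norm_iteratedFDeriv_comp_le (𝕜 := ℝ) (g := Real.exp) (f := fun y : E => -‖y‖ ^ 2)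
      (n := n) (N := (n : WithTop ℕ∞)) Real.contDiff_exp ((contDiff_norm_sq ℝ).neg) le_rfl x
      (C := Real.exp (-‖x‖ ^ 2)) (D := 2 * (1 + ‖x‖) ^ 2)
      (fun i _ => by
        rw [norm_iteratedFDeriv_eq_norm_iteratedDeriv, iteratedDeriv_eq_iterate,
          Real.iter_deriv_exp]
        simp)
      (fun i hi _ => norm_iteratedFDeriv_normSq_le i hi x)
    have h' : ‖iteratedFDeriv ℝ n (fun x : E => Real.exp (-‖x‖ ^ 2)) x‖ ≤ _ := h
    calc ‖x‖ ^ k * ‖iteratedFDeriv ℝ n (fun x : E => Real.exp (-‖x‖ ^ 2)) x‖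
        ≤ (1 + ‖x‖) ^ k *
          (n.factorial * Real.exp (-‖x‖ ^ 2) * (2 * (1 + ‖x‖) ^ 2) ^ n) := by
          gcongr; simp
      _ = n.factorial * 2 ^ n * ((1 + ‖x‖) ^ (k + 2 * n) * Real.exp (-‖x‖ ^ 2)) := by
          rw [mul_pow, pow_add, pow_mul]; ring
      _ ≤ _ := by gcongr; exact hC _ (norm_nonneg _)

lemma stdGaussian_apply (x : E) : stdGaussian E x = Real.exp (-‖x‖ ^ 2) := rfl

end Gaussian

/-- The coordinatewise rescaling of `ℝⁿ`. -/
def diagEquiv {n : ℕ} (a : Fin n → ℝ) (ha : ∀ j, a j ≠ 0) : Rn n ≃L[ℝ] Rn n :=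
  ((WithLp.linearEquiv 2 ℝ (Fin n → ℝ)).trans ((LinearEquiv.piCongrRight
    fun j => LinearEquiv.smulOfNeZero ℝ ℝ (a j) (ha j)).trans
      (WithLp.linearEquiv 2 ℝ (Fin n → ℝ)).symm)).toContinuousLinearEquiv

lemma diagEquiv_apply {n : ℕ} (a : Fin n → ℝ) (ha : ∀ j, a j ≠ 0) (x : Rn n) (j : Fin n) :
    diagEquiv a ha x j = a j * x j := rfl

/-- The Gaussian `exp (-∑ (a_j x_j)²)` as a complex Schwartz function. -/
def diagGaussian {n : ℕ} (a : Fin n → ℝ) (ha : ∀ j, a j ≠ 0) : 𝓢(Rn n, ℂ) :=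
  SchwartzMap.postcompCLM (𝕜 := ℝ) Complex.ofRealCLM
    (SchwartzMap.compCLMOfContinuousLinearEquiv ℝ (diagEquiv a ha) (stdGaussian (Rn n)))

lemma diagGaussian_apply {n : ℕ} (a : Fin n → ℝ) (ha : ∀ j, a j ≠ 0) (x : Rn n) :
    diagGaussian a ha x = ((Real.exp (-∑ j, (a j * x j) ^ 2) : ℝ) : ℂ) := by
  simp only [diagGaussian, SchwartzMap.postcompCLM_apply,
    SchwartzMap.compCLMOfContinuousLinearEquiv_apply, Function.comp, stdGaussian_apply,
    EuclideanSpace.norm_sq_eq, diagEquiv_apply, Real.norm_eq_abs, sq_abs]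
  rfl

/-- The Gaussian window as a Schwartz function. -/
def windowS (hbar : ℝ) (hbar_pos : 0 < hbar) (q : ℕ → ℝ) (q_pos : ∀ j, 0 < q j) (n : ℕ) :
    𝓢(Rn n, ℂ) :=
  (((2 * Real.pi * hbar) ^ (-(n : ℝ) / 2) : ℝ) : ℂ) •
    diagGaussian (fun j : Fin n => √(q j / (2 * hbar)))
      (fun j => (Real.sqrt_pos.2 (div_pos (q_pos j) (by positivity))).ne')

lemma windowS_coe (hbar : ℝ) (hbar_pos : 0 < hbar) (q : ℕ → ℝ) (q_pos : ∀ j, 0 < q j) (n : ℕ) :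
    (windowS hbar hbar_pos q q_pos n : Rn n → ℂ) = window hbar q n := by
  ext x
  simp only [windowS, smul_apply, diagGaussian_apply, window, smul_eq_mul]
  push_cast
  congr 3
  rw [Finset.mul_sum, ← Finset.sum_neg_distrib]
  refine Finset.sum_congr rfl fun j _ => ?_
  rw [mul_pow, ← Complex.ofReal_pow, Real.sq_sqrt (div_nonneg (q_pos j).le (by positivity))]
  push_cast
  ring

/-! ### The semiclassical Fourier transform: inversion and convolution -/

section HFT

open scoped FourierTransform

variable {E : Type*} [NormedAddCommGroup E] [InnerProductSpace ℝ E]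
  [MeasurableSpace E] [BorelSpace E]

/-- The semiclassical Fourier transform `∫ e^{-(i/ħ) ξ·y} h(y) dy`, without normalization. -/
def hft [FiniteDimensional ℝ E] (hbar : ℝ) (h : E → ℂ) (ξ : E) : ℂ :=
  ∫ y : E, Complex.exp (-(Complex.I / (hbar : ℂ)) * ((inner ℝ ξ y : ℝ) : ℂ)) * h y

lemma norm_cexp_phase (hbar r : ℝ) :
    ‖Complex.exp (-(Complex.I / (hbar : ℂ)) * (r : ℂ))‖ = 1 := by
  have : -(Complex.I / (hbar : ℂ)) * (r : ℂ) = ((-(r / hbar) : ℝ) : ℂ) * Complex.I := by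
    push_cast; ring
  rw [this, Complex.norm_exp_ofReal_mul_I]

lemma norm_cexp_phase_sq (hbar r : ℝ) :
    ‖Complex.exp (Complex.I / (2 * (hbar : ℂ)) * (r : ℂ))‖ = 1 := by
  have : Complex.I / (2 * (hbar : ℂ)) * (r : ℂ) = ((r / (2 * hbar) : ℝ) : ℂ) * Complex.I := by
    push_cast; ring
  rw [this, Complex.norm_exp_ofReal_mul_I]

variable [FiniteDimensional ℝ E]

lemma integrable_phase_mul (hbar : ℝ) {h : E → ℂ} (hh : Integrable h) (ξ : E) :
    Integrable fun y : E =>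
      Complex.exp (-(Complex.I / (hbar : ℂ)) * ((inner ℝ ξ y : ℝ) : ℂ)) * h y := by
  refine hh.bdd_mul (c := 1) (Continuous.aestronglyMeasurable (by fun_prop)) ?_
  exact .of_forall fun y => (norm_cexp_phase _ _).le

lemma hft_eq_fourier (hbar : ℝ) (h : E → ℂ) (ξ : E) :
    hft hbar h ξ = 𝓕 h ((2 * Real.pi * hbar)⁻¹ • ξ) := by
  rw [Real.fourier_eq', hft]
  refine integral_congr_ae (.of_forall fun y => ?_)
  simp only [smul_eq_mul, inner_smul_right, real_inner_comm]
  congr 2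
  have := Real.pi_pos.ne'
  push_cast
  field_simp

lemma norm_hft_le (hbar : ℝ) (h : E → ℂ) (ξ : E) : ‖hft hbar h ξ‖ ≤ ∫ y, ‖h y‖ := by
  refine (norm_integral_le_integral_norm _).trans_eq ?_
  simp only [norm_mul, norm_cexp_phase, one_mul]

lemma continuous_hft (hbar : ℝ) {h : E → ℂ} (hh : Integrable h) : Continuous (hft hbar h) := by
  refine continuous_of_dominated (bound := fun y => ‖h y‖)
    (fun ξ => (integrable_phase_mul hbar hh ξ).aestronglyMeasurable)
    (fun ξ => .of_forall fun y => ?_) hh.norm (.of_forall fun y => ?_)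
  · rw [norm_mul, norm_cexp_phase, one_mul]
  · fun_prop

lemma hft_sub (hbar : ℝ) {h k : E → ℂ} (hh : Integrable h) (hk : Integrable k) (ξ : E) :
    hft hbar (fun y => h y - k y) ξ = hft hbar h ξ - hft hbar k ξ := by
  simp only [hft, mul_sub]
  exact integral_sub (integrable_phase_mul hbar hh ξ) (integrable_phase_mul hbar hk ξ)

lemma lintegral_hft {hbar : ℝ} (hbar_pos : 0 < hbar) (h : E → ℂ) :
    ∫⁻ ξ, ‖hft hbar h ξ‖ₑ =
      ENNReal.ofReal ((2 * Real.pi * hbar) ^ Module.finrank ℝ E) * ∫⁻ ξ, ‖𝓕 h ξ‖ₑ := by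
  have hc : (0 : ℝ) < 2 * Real.pi * hbar := by positivity
  simp only [hft_eq_fourier]
  have h1 := lintegral_map_equiv (μ := (volume : Measure E)) (fun ξ => ‖𝓕 h ξ‖ₑ)
    (Homeomorph.smulOfNeZero ((2 * Real.pi * hbar)⁻¹) (inv_pos.2 hc).ne' :
      E ≃ₜ E).toMeasurableEquiv
  have h2 : Measure.map ((Homeomorph.smulOfNeZero ((2 * Real.pi * hbar)⁻¹) (inv_pos.2 hc).ne' :
    E ≃ₜ E).toMeasurableEquiv) volume = ENNReal.ofReal
      |(((2 * Real.pi * hbar)⁻¹) ^ Module.finrank ℝ E)⁻¹| • (volume : Measure E) :=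
    Measure.map_addHaar_smul volume (inv_pos.2 hc).ne'
  rw [h2, lintegral_smul_measure] at h1
  rw [smul_eq_mul, inv_pow, inv_inv, abs_of_pos (by positivity)] at h1
  exact h1.symm

/-- A continuous integrable function is bounded by the `L¹` norm of its Fourier transform. -/
lemma enorm_le_lintegral_hft {hbar : ℝ} (hbar_pos : 0 < hbar) {h : E → ℂ} (hc : Continuous h)
    (hh : Integrable h) (y : E) :
    ENNReal.ofReal ((2 * Real.pi * hbar) ^ Module.finrank ℝ E) * ‖h y‖ₑ
      ≤ ∫⁻ ξ, ‖hft hbar h ξ‖ₑ := by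
  rw [lintegral_hft hbar_pos]
  gcongr
  -- The bound is trivial unless the transform is integrable; then inversion holds at every point
  -- because `h` is continuous.
  by_cases hF : ∫⁻ ξ, ‖𝓕 h ξ‖ₑ = ∞
  · rw [hF]; exact le_top
  have hcont : Continuous (𝓕 h) :=
    VectorFourier.fourierIntegral_continuous Real.continuous_fourierChar continuous_inner hh
  have hI : Integrable (𝓕 h) := ⟨hcont.aestronglyMeasurable, lt_top_iff_ne_top.2 hF⟩
  rw [← hc.fourierInv_fourier_eq hh hI, Real.fourierInv_eq']
  refine (enorm_integral_le_lintegral_enorm _).trans_eq ?_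
  refine lintegral_congr fun ξ => ?_
  rw [enorm_smul]
  have : ‖Complex.exp (↑(2 * Real.pi * inner ℝ ξ y) * Complex.I)‖ₑ = 1 := by
    rw [← ofReal_norm, Complex.norm_exp_ofReal_mul_I]; simp
  rw [this, one_mul, hc.fourierInv_fourier_eq hh hI]

/-- Fourier inversion, with the frequency scaled so that the exponential merges with the phase of
`hft` as a frequency shift. -/
lemma schwartz_apply_eq_integral_fourier (k : 𝓢(E, ℂ)) {hbar : ℝ} (hbar_pos : 0 < hbar) (y : E) :
    k y = ∫ η, 𝓕 k η * Complex.exp ((Complex.I / (hbar : ℂ)) *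
      ((inner ℝ ((2 * Real.pi * hbar) • η) y : ℝ) : ℂ)) := by
  have h1 : 𝓕⁻ (𝓕 k) y = k y := by rw [FourierTransform.fourierInv_fourier_eq]
  rw [← h1, SchwartzMap.fourierInv_coe, Real.fourierInv_eq']
  refine integral_congr_ae (.of_forall fun η => ?_)
  simp only [smul_eq_mul]
  rw [mul_comm]
  congr 2
  rw [inner_smul_left]
  have : (hbar : ℂ) ≠ 0 := Complex.ofReal_ne_zero.2 hbar_pos.ne'
  push_cast
  simp
  field_simp

/-- The Fourier transform of a product with a rescaled Schwartz function is a convolution. -/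
lemma hft_mul_schwartz_smul {hbar : ℝ} (hbar_pos : 0 < hbar) {h : E → ℂ} (hh : Integrable h)
    (k : 𝓢(E, ℂ)) (ε : ℝ) (ξ : E) :
    hft hbar (fun y => h y * k (ε • y)) ξ =
      ∫ η, 𝓕 k η * hft hbar h (ξ - (2 * Real.pi * hbar * ε) • η) := by
  simp only [hft]
  have e1 : ∀ η y : E, Complex.exp (-(Complex.I / (hbar : ℂ)) *
      ((inner ℝ (ξ - (2 * Real.pi * hbar * ε) • η) y : ℝ) : ℂ)) =
      Complex.exp (-(Complex.I / (hbar : ℂ)) * ((inner ℝ ξ y : ℝ) : ℂ)) *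
      Complex.exp ((Complex.I / (hbar : ℂ)) *
        ((inner ℝ ((2 * Real.pi * hbar) • η) (ε • y) : ℝ) : ℂ)) := by
    intro η y
    rw [← Complex.exp_add, inner_sub_left, inner_smul_left, inner_smul_left, inner_smul_right]
    congr 1
    simp only [conj_trivial]
    push_cast
    ring
  simp_rw [← integral_const_mul]
  rw [integral_integral_swap]
  · refine integral_congr_ae (.of_forall fun y => ?_)
    simp only
    rw [schwartz_apply_eq_integral_fourier k hbar_pos (ε • y), ← integral_const_mul,
      ← integral_const_mul]
    refine integral_congr_ae (.of_forall fun η => ?_)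
    simp only [e1]
    ring
  · have := (𝓕 k : 𝓢(E, ℂ)).integrable (μ := volume) |>.mul_prod hh
    refine (this.bdd_mul (c := 1) (f := fun p : E × E => Complex.exp (-(Complex.I / (hbar : ℂ)) *
      ((inner ℝ (ξ - (2 * Real.pi * hbar * ε) • p.1) p.2 : ℝ) : ℂ)))
      (Continuous.aestronglyMeasurable (by fun_prop))
      (.of_forall fun y => (norm_cexp_phase _ _).le)).congr (.of_forall fun p => ?_)
    simp only [Function.uncurry]
    ring

/-- The Fourier transform of a product with a Schwartz function is a convolution. -/
lemma hft_mul_schwartz {hbar : ℝ} (hbar_pos : 0 < hbar) {h : E → ℂ} (hh : Integrable h)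
    (k : 𝓢(E, ℂ)) (ξ : E) :
    hft hbar (fun y => h y * k y) ξ =
      ∫ η, 𝓕 k η * hft hbar h (ξ - (2 * Real.pi * hbar) • η) := by
  simpa using hft_mul_schwartz_smul hbar_pos hh k 1 ξ

end HFT

/-! ### The Gabor transform as a Fourier transform -/

section Stft

variable {n : ℕ}

lemma stft_eq_hft (hbar : ℝ) (g f : Rn n → ℂ) (x ξ : Rn n) :
    stft hbar g f x ξ = (((2 * Real.pi * hbar) ^ (-(n : ℝ) / 2) : ℝ) : ℂ) *
      hft hbar (fun y => f y * (starRingEnd ℂ) (g (y - x))) ξ := by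
  simp only [stft, hft, mul_assoc]

/-- The conjugated and translated Schwartz function `y ↦ conj (g (y - x))`. -/
def conjShift (g : 𝓢(Rn n, ℂ)) (x : Rn n) : 𝓢(Rn n, ℂ) :=
  SchwartzMap.compSubConstCLM ℝ x
    (SchwartzMap.postcompCLM (𝕜 := ℝ) (Complex.conjCLE : ℂ →L[ℝ] ℂ) g)

lemma conjShift_apply (g : 𝓢(Rn n, ℂ)) (x y : Rn n) :
    conjShift g x y = (starRingEnd ℂ) (g (y - x)) := rfl

lemma integrable_mul_schwartz {f : Rn n → ℂ} (hf : Continuous f) {B : ℝ} (hB : ∀ x, ‖f x‖ ≤ B)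
    (φ : 𝓢(Rn n, ℂ)) : Integrable fun x => f x * φ x :=
  φ.integrable.bdd_mul hf.aestronglyMeasurable (.of_forall hB)

lemma measurable_iSup_stft (hbar : ℝ) {g f : Rn n → ℂ}
    (h : ∀ x, Integrable fun y => f y * (starRingEnd ℂ) (g (y - x))) :
    Measurable fun ξ : Rn n => ⨆ x : Rn n, ‖stft hbar g f x ξ‖ₑ := by
  refine (lowerSemicontinuous_iSup fun x => ?_).measurable
  refine Continuous.lowerSemicontinuous ?_
  simp only [stft_eq_hft]
  exact (continuous_const.mul (continuous_hft hbar (h x))).enorm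

end Stft

open scoped FourierTransform

/-! ### Decay of Fourier transforms of products of windows -/

section SchwartzBounds

variable {E : Type*} [NormedAddCommGroup E] [InnerProductSpace ℝ E]

lemma exists_weighted_iteratedFDeriv_le (g : 𝓢(E, ℂ)) (K l : ℕ) :
    ∃ A : ℝ, 0 ≤ A ∧ ∀ i ≤ l, ∀ x, (1 + ‖x‖) ^ K * ‖iteratedFDeriv ℝ i g x‖ ≤ A :=
  ⟨_, (by positivity : 0 ≤ 2 ^ K * (Finset.Iic (K, l)).sup
      (fun m => SchwartzMap.seminorm ℝ m.1 m.2) g),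
    fun i hi x => SchwartzMap.one_add_le_sup_seminorm_apply (𝕜 := ℝ) (m := (K, l)) le_rfl hi g x⟩

/-- The product of `g₀` with a translate of `g`. -/
def mulShift (g₀ g : 𝓢(E, ℂ)) (u : E) : 𝓢(E, ℂ) :=
  SchwartzMap.pairing (ContinuousLinearMap.mul ℝ ℂ) g₀ (SchwartzMap.compSubConstCLM ℝ (-u) g)

lemma mulShift_apply (g₀ g : 𝓢(E, ℂ)) (u z : E) : mulShift g₀ g u z = g₀ z * g (z + u) := by
  simp [mulShift, SchwartzMap.pairing_apply_apply]

/-- By Peetre's inequality 1 + ‖u‖ ≤ (1 + ‖x‖)(1 + ‖x + u‖), decay in the shift is paid for by the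
decay of the two factors. -/
lemma exists_seminorm_mulShift_le (g₀ g : 𝓢(E, ℂ)) (M : ℕ) (m : ℕ × ℕ) :
    ∃ A : ℝ, 0 ≤ A ∧ ∀ u : E,
      schwartzSeminormFamily ℂ E ℂ m (mulShift g₀ g u) ≤ A * ((1 + ‖u‖) ^ M)⁻¹ := by
  obtain ⟨k, l⟩ := m
  obtain ⟨A, hA, hA'⟩ := exists_weighted_iteratedFDeriv_le g₀ (k + M) l
  obtain ⟨B, hB, hB'⟩ := exists_weighted_iteratedFDeriv_le g M l
  refine ⟨2 ^ l * (A * B), by positivity, fun u => ?_⟩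
  refine SchwartzMap.seminorm_le_bound ℂ k l _ (by positivity) fun x => ?_
  have h1 : (mulShift g₀ g u : E → ℂ) = fun z => g₀ z * g (z + u) := by
    ext z; exact mulShift_apply _ _ _ _
  rw [h1]
  have hg : ContDiff ℝ l fun z => g (z + u) := (g.smooth l).comp (contDiff_id.add contDiff_const)
  have h2 := norm_iteratedFDeriv_mul_le (𝕜 := ℝ) (N := (l : WithTop ℕ∞)) (g₀.smooth l) hg x le_rfl
  have hu : (1 + ‖u‖) ≤ (1 + ‖x‖) * (1 + ‖x + u‖) := by
    have : ‖u‖ ≤ ‖x + u‖ + ‖x‖ := by simpa using norm_sub_le (x + u) x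
    nlinarith [norm_nonneg x, norm_nonneg (x + u)]
  rw [← div_eq_mul_inv, le_div_iff₀ (by positivity)]
  calc ‖x‖ ^ k * ‖iteratedFDeriv ℝ l (fun z => g₀ z * g (z + u)) x‖ * (1 + ‖u‖) ^ M
      ≤ (1 + ‖x‖) ^ k * (∑ i ∈ Finset.range (l + 1), (l.choose i : ℝ) *
          ‖iteratedFDeriv ℝ i g₀ x‖ * ‖iteratedFDeriv ℝ (l - i) g (x + u)‖) *
            ((1 + ‖x‖) * (1 + ‖x + u‖)) ^ M := by
        gcongr
        · simp
        · simpa only [iteratedFDeriv_comp_add_right] using h2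
    _ = ∑ i ∈ Finset.range (l + 1), (l.choose i : ℝ) *
          (((1 + ‖x‖) ^ (k + M) * ‖iteratedFDeriv ℝ i g₀ x‖) *
            ((1 + ‖x + u‖) ^ M * ‖iteratedFDeriv ℝ (l - i) g (x + u)‖)) := by
        rw [Finset.mul_sum, Finset.sum_mul]
        refine Finset.sum_congr rfl fun i _ => ?_
        rw [mul_pow, pow_add]; ring
    _ ≤ ∑ i ∈ Finset.range (l + 1), (l.choose i : ℝ) * (A * B) := by
        refine Finset.sum_le_sum fun i hi => ?_
        gcongr
        · exact hA' i (by simp at hi; omega) x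
        · exact hB' _ (by omega) _
    _ = 2 ^ l * (A * B) := by
        rw [← Finset.sum_mul]
        congr 1
        exact_mod_cast Nat.sum_range_choose l

variable [FiniteDimensional ℝ E] [MeasurableSpace E] [BorelSpace E]

/-- The Fourier transforms of the products `g₀ · g(· + u)` decay rapidly, also in `u`. -/
lemma exists_fourier_mulShift_le (g₀ g : 𝓢(E, ℂ)) (M : ℕ) :
    ∃ A : ℝ, 0 ≤ A ∧ ∀ u η : E,
      ‖𝓕 (mulShift g₀ g u) η‖ ≤ A * ((1 + ‖u‖) ^ M)⁻¹ * ((1 + ‖η‖) ^ M)⁻¹ := by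
  -- The Fourier transform is continuous on Schwartz space, so finitely many seminorms of the
  -- product control the weighted supremum of its transform; each of them decays in `u`.
  let Q : Seminorm ℂ 𝓢(E, ℂ) := ((Finset.Iic (M, 0)).sup (schwartzSeminormFamily ℂ E ℂ)).comp
    (SchwartzMap.fourierTransformCLM ℂ : 𝓢(E, ℂ) →L[ℂ] 𝓢(E, ℂ)).toLinearMap
  have hQ : Continuous Q := by
    exact (Seminorm.continuous_finsetSup (s := Finset.Iic (M, 0)) fun i _ =>
      (schwartz_withSeminorms ℂ E ℂ).continuous_seminorm i).comp (SchwartzMap.fourierTransformCLM ℂ : 𝓢(E, ℂ) →L[ℂ] 𝓢(E, ℂ)).continuous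
  obtain ⟨s, C, -, hC⟩ := Seminorm.bound_of_continuous (schwartz_withSeminorms ℂ E ℂ) Q hQ
  choose A hA hA' using exists_seminorm_mulShift_le g₀ g M
  have hs : 0 ≤ ∑ m ∈ s, A m := Finset.sum_nonneg fun m _ => hA m
  refine ⟨2 ^ M * (C * ∑ m ∈ s, A m), by positivity, fun u η => ?_⟩
  rw [← div_eq_mul_inv, le_div_iff₀ (by positivity), mul_comm]
  have h1 := SchwartzMap.one_add_le_sup_seminorm_apply (𝕜 := ℂ) (m := (M, 0)) (k := M) (n := 0)
    le_rfl le_rfl (𝓕 (mulShift g₀ g u)) η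
  rw [norm_iteratedFDeriv_zero] at h1
  refine h1.trans ?_
  rw [mul_assoc, mul_assoc]
  refine mul_le_mul_of_nonneg_left ((hC (mulShift g₀ g u)).trans ?_) (by positivity)
  change (C : ℝ) * (s.sup (schwartzSeminormFamily ℂ E ℂ)) (mulShift g₀ g u) ≤ _
  refine mul_le_mul_of_nonneg_left ?_ C.2
  refine Seminorm.finset_sup_apply_le (by positivity) fun m hm => (hA' m u).trans ?_
  gcongr
  exact Finset.single_le_sum (fun m _ => hA m) hm

lemma norm_fourier_comp_sub (h : E → ℂ) (a η : E) : ‖𝓕 (fun y => h (y - a)) η‖ = ‖𝓕 h η‖ := by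
  have := congrFun (VectorFourier.fourierIntegral_comp_add_right Real.fourierChar
    (volume : Measure E) (innerₗ E) h (-a)) η
  have h2 : (h ∘ fun v => v + -a) = fun y => h (y - a) := by
    ext y; simp [sub_eq_add_neg]
  rw [h2] at this
  change 𝓕 (fun y => h (y - a)) η = _ • 𝓕 h η at this
  rw [this, Circle.norm_smul]

lemma lintegral_inv_one_add_norm_lt_top :
    ∫⁻ x : E, ENNReal.ofReal ((1 + ‖x‖) ^ (Module.finrank ℝ E + 1))⁻¹ < ∞ := by
  have h := finite_integral_one_add_norm (E := E) (μ := volume)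
    (r := (Module.finrank ℝ E + 1 : ℕ)) (by push_cast; linarith)
  convert h using 4 with x
  rw [Real.rpow_neg (by positivity), Real.rpow_natCast]

end SchwartzBounds

/-! ### Boundedness, and independence of the window -/

section WindowChange

variable {n : ℕ}

lemma lintegral_stft_le_sjNorm (hbar : ℝ) (g f : Rn n → ℂ) (x : Rn n) :
    ∫⁻ ξ, ‖stft hbar g f x ξ‖ₑ ≤ sjNorm hbar g f :=
  lintegral_mono fun ξ => le_iSup (fun x => ‖stft hbar g f x ξ‖ₑ) x

/-- For fixed `x` the Gabor transform is the Fourier transform of f · conj g(· - x), so inversion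
applies. The exponent n/2 is n from inversion minus n/2 from the normalization. -/
lemma enorm_mul_le_sjNorm {hbar : ℝ} (hbar_pos : 0 < hbar) {g f : Rn n → ℂ} (hf : Continuous f)
    (hg : Continuous g) {x : Rn n}
    (hi : Integrable fun y => f y * (starRingEnd ℂ) (g (y - x))) (y : Rn n) :
    ENNReal.ofReal ((2 * Real.pi * hbar) ^ ((n : ℝ) / 2)) * (‖f y‖ₑ * ‖g (y - x)‖ₑ) ≤
      sjNorm hbar g f := by
  refine le_trans ?_ (lintegral_stft_le_sjNorm hbar g f x)
  simp only [stft_eq_hft, enorm_mul]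
  rw [lintegral_const_mul' _ _ enorm_ne_top]
  refine le_trans ?_ (mul_le_mul_right (enorm_le_lintegral_hft hbar_pos
    (hf.mul (Complex.continuous_conj.comp (hg.comp (continuous_id.sub continuous_const)))) hi y) _)
  have hc : (0 : ℝ) < 2 * Real.pi * hbar := by positivity
  have e1 : ‖(((2 * Real.pi * hbar) ^ (-(n : ℝ) / 2) : ℝ) : ℂ)‖ₑ =
      ENNReal.ofReal ((2 * Real.pi * hbar) ^ (-(n : ℝ) / 2)) := by
    rw [← ofReal_norm, Complex.norm_real, Real.norm_of_nonneg (by positivity)]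
  rw [e1, ← mul_assoc (ENNReal.ofReal ((2 * Real.pi * hbar) ^ (-(n : ℝ) / 2))),
    ← ENNReal.ofReal_mul (by positivity), finrank_euclideanSpace, Fintype.card_fin,
    ← Real.rpow_natCast, ← Real.rpow_add hc]
  refine le_of_eq ?_
  congr 2
  · congr 1; ring
  · simp [enorm_mul]

/-- Functions in the Sjöstrand class are bounded. -/
lemma exists_norm_le_of_sjNorm_lt_top {hbar : ℝ} (hbar_pos : 0 < hbar) {f : Rn n → ℂ}
    (hf : Continuous f) (hφ : ∀ φ : 𝓢(Rn n, ℂ), Integrable (fun x => f x * φ x))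
    {g : 𝓢(Rn n, ℂ)} (hg : g ≠ 0) (hN : sjNorm hbar g f < ∞) : ∃ B : ℝ, ∀ x, ‖f x‖ ≤ B := by
  obtain ⟨y₀, hy₀⟩ : ∃ y, g y ≠ 0 := by
    by_contra! h
    exact hg (by ext y; simp [h y])
  have hc : (0 : ℝ) < 2 * Real.pi * hbar := by positivity
  have hK : ENNReal.ofReal ((2 * Real.pi * hbar) ^ ((n : ℝ) / 2)) * ‖g y₀‖ₑ ≠ 0 :=
    mul_ne_zero (by simpa using Real.rpow_pos_of_pos hc _) (by simpa using hy₀)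
  have hK' : ENNReal.ofReal ((2 * Real.pi * hbar) ^ ((n : ℝ) / 2)) * ‖g y₀‖ₑ ≠ ∞ :=
    ENNReal.mul_ne_top ENNReal.ofReal_ne_top enorm_ne_top
  refine ⟨(sjNorm hbar g f / (ENNReal.ofReal ((2 * Real.pi * hbar) ^ ((n : ℝ) / 2)) *
    ‖g y₀‖ₑ)).toReal, fun y => ?_⟩
  -- Centering the window at y - y₀ makes its value at `y` the fixed nonzero number g(y₀), whence a
  -- bound uniform in `y`.
  have h := enorm_mul_le_sjNorm hbar_pos hf g.continuous (x := y - y₀)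
    (hφ (conjShift g (y - y₀))) y
  rw [sub_sub_cancel, mul_left_comm, ← ENNReal.le_div_iff_mul_le (.inl hK) (.inl hK')] at h
  rw [← toReal_enorm]
  exact ENNReal.toReal_mono (ENNReal.div_ne_top hN.ne hK) h

/-- The decay weight `(1 + ‖x‖)^{-(n+1)}`, integrable over `ℝⁿ`. -/
def decayWeight (x : Rn n) : ℝ≥0∞ := ENNReal.ofReal ((1 + ‖x‖) ^ (n + 1))⁻¹

lemma measurable_decayWeight : Measurable (decayWeight : Rn n → ℝ≥0∞) := by
  unfold decayWeight; fun_prop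

lemma decayWeight_ne_top (x : Rn n) : decayWeight x ≠ ∞ := ENNReal.ofReal_ne_top

lemma lintegral_decayWeight_lt_top : ∫⁻ x : Rn n, decayWeight x < ∞ := by
  simpa [decayWeight] using lintegral_inv_one_add_norm_lt_top (E := Rn n)

/-- ∫ |g₀(y - x')|² dx' does not depend on `y`, so it can be inserted under the integral and Fubini
applied. This expresses the transform with window `g` through products of `f` with translates of g₀.
-/
lemma integral_normSq_mul_hft {hbar : ℝ} {g₀ g : 𝓢(Rn n, ℂ)} {f : Rn n → ℂ}
    (hf : Continuous f) {B : ℝ} (hB : ∀ x, ‖f x‖ ≤ B) (x ξ : Rn n) :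
    (∫ z, g₀ z * (starRingEnd ℂ) (g₀ z)) *
        hft hbar (fun y => f y * (starRingEnd ℂ) (g (y - x))) ξ =
      ∫ x', hft hbar (fun y => (f y * (starRingEnd ℂ) (g₀ (y - x'))) *
        (g₀ (y - x') * (starRingEnd ℂ) (g (y - x)))) ξ := by
  have hg₀ : Integrable fun z => g₀ z * (starRingEnd ℂ) (g₀ z) := by
    simpa only [conjShift_apply, sub_zero] using integrable_mul_schwartz g₀.continuous
      (fun x => SchwartzMap.norm_le_seminorm ℝ g₀ x) (conjShift g₀ 0)
  have hfg := integrable_phase_mul hbar (integrable_mul_schwartz hf hB (conjShift g x)) ξ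
  simp only [hft]
  rw [integral_integral_swap]
  · rw [← integral_const_mul]
    refine integral_congr_ae (.of_forall fun y => ?_)
    simp only
    rw [← integral_sub_left_eq_self (fun z => g₀ z * (starRingEnd ℂ) (g₀ z)) volume y,
      ← integral_mul_const]
    refine integral_congr_ae (.of_forall fun x' => ?_)
    ring
  · refine ((hfg.convolution_integrand (ContinuousLinearMap.mul ℝ ℂ)
      hg₀.comp_neg)).congr (.of_forall fun p => ?_)
    simp only [Function.uncurry, ContinuousLinearMap.mul_apply', conjShift_apply, neg_sub]
    ring

/-- Windows can be exchanged in the definition of the Sjöstrand class. -/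
lemma sjNorm_lt_top_of_window {hbar : ℝ} (hbar_pos : 0 < hbar) {g₀ g : 𝓢(Rn n, ℂ)} {f : Rn n → ℂ}
    (hg₀ : g₀ ≠ 0) (hf : Continuous f) {B : ℝ} (hB : ∀ x, ‖f x‖ ≤ B)
    (hN : sjNorm hbar g₀ f < ∞) : sjNorm hbar g f < ∞ := by
  set c : ℝ≥0∞ := ‖(((2 * Real.pi * hbar) ^ (-(n : ℝ) / 2) : ℝ) : ℂ)‖ₑ with hc_def
  set S : Rn n → ℝ≥0∞ := fun ξ => ⨆ x, ‖stft hbar g₀ f x ξ‖ₑ with hS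
  have hSm : Measurable S := measurable_iSup_stft hbar fun x =>
    integrable_mul_schwartz hf hB (conjShift g₀ x)
  obtain ⟨A, hA, hA'⟩ := exists_fourier_mulShift_le g₀ (conjShift g 0) (n + 1)
  set D : ℂ := ∫ z, g₀ z * (starRingEnd ℂ) (g₀ z) with hD
  have hD0 : D ≠ 0 := by
    have e : ∀ z, g₀ z * (starRingEnd ℂ) (g₀ z) = ((‖g₀ z‖ ^ 2 : ℝ) : ℂ) := fun z => by
      rw [Complex.mul_conj, Complex.normSq_eq_norm_sq]
    simp only [hD, e]
    rw [integral_complex_ofReal, Complex.ofReal_ne_zero]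
    obtain ⟨y₀, hy₀⟩ : ∃ y, g₀ y ≠ 0 := by
      by_contra! h
      exact hg₀ (by ext y; simp [h y])
    have hi : Integrable fun z => ‖g₀ z‖ ^ 2 := by
      have := (integrable_mul_schwartz g₀.continuous
        (fun x => SchwartzMap.norm_le_seminorm ℝ g₀ x) (conjShift g₀ 0)).norm
      refine this.congr (.of_forall fun z => ?_)
      simp [conjShift_apply, pow_two]
    intro h0
    rw [integral_eq_zero_iff_of_nonneg (fun z => by positivity) hi,
      Continuous.ae_eq_iff_eq volume (by fun_prop) continuous_zero] at h0
    have := congrFun h0 y₀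
    simp [hy₀] at this
  -- A majorant free of `x`: the rapidly decaying kernel spreads out the supremum `S` for the old
  -- window. Integrating it in ξ only multiplies the old norm by a finite constant.
  set W : Rn n → ℝ≥0∞ := fun ξ =>
    ∫⁻ η, decayWeight η * S (ξ - (2 * Real.pi * hbar) • η) with hW
  have hker : ∀ x x' η : Rn n,
      ‖𝓕 (mulShift g₀ (conjShift g 0) (x' - x)) η‖ₑ ≤
        ENNReal.ofReal A * decayWeight (x' - x) * decayWeight η := by
    intro x x' η
    rw [decayWeight, decayWeight, ← ENNReal.ofReal_mul hA, ← ENNReal.ofReal_mul (by positivity),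
      ← ofReal_norm]
    exact ENNReal.ofReal_le_ofReal (hA' _ _)
  have hpt : ∀ x ξ : Rn n, ‖D‖ₑ * ‖stft hbar g f x ξ‖ₑ ≤
      ENNReal.ofReal A * (∫⁻ u : Rn n, decayWeight u) * W ξ := by
    intro x ξ
    rw [stft_eq_hft, enorm_mul, ← hc_def, mul_left_comm, ← enorm_mul, hD,
      integral_normSq_mul_hft hf hB]
    refine (mul_le_mul_right (enorm_integral_le_lintegral_enorm _) _).trans ?_
    rw [← lintegral_const_mul' _ _ enorm_ne_top]
    have hx' : ∀ x', c * ‖hft hbar (fun y => (f y * (starRingEnd ℂ) (g₀ (y - x'))) *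
        (g₀ (y - x') * (starRingEnd ℂ) (g (y - x)))) ξ‖ₑ ≤
        ENNReal.ofReal A * W ξ * decayWeight (x' - x) := by
      intro x'
      set k : 𝓢(Rn n, ℂ) := SchwartzMap.compSubConstCLM ℝ x'
        (mulShift g₀ (conjShift g 0) (x' - x)) with hk
      have hkv : ∀ y, k y = g₀ (y - x') * (starRingEnd ℂ) (g (y - x)) := fun y => by
        simp [hk, mulShift_apply, conjShift_apply]
      have hkF : ∀ η, ‖𝓕 k η‖ₑ ≤
          ENNReal.ofReal A * decayWeight (x' - x) * decayWeight η := by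
        intro η
        refine le_trans (le_of_eq ?_) (hker x x' η)
        rw [← ofReal_norm, ← ofReal_norm]
        congr 1
        exact norm_fourier_comp_sub (mulShift g₀ (conjShift g 0) (x' - x)) x' η
      simp_rw [← hkv]
      have hconv := hft_mul_schwartz hbar_pos
        (integrable_mul_schwartz hf hB (conjShift g₀ x')) k ξ
      simp only [conjShift_apply] at hconv
      rw [hconv]
      refine (mul_le_mul_right (enorm_integral_le_lintegral_enorm _) _).trans ?_
      rw [← lintegral_const_mul' _ _ enorm_ne_top]
      calc _ ≤ ∫⁻ η, ENNReal.ofReal A * decayWeight (x' - x) *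
            (decayWeight η * S (ξ - (2 * Real.pi * hbar) • η)) := by
            refine lintegral_mono fun η => ?_
            rw [enorm_mul, mul_left_comm, ← mul_assoc _ (decayWeight η)]
            refine mul_le_mul' (hkF η) ?_
            rw [← enorm_mul]
            refine le_trans (le_of_eq ?_) (le_iSup _ x')
            rw [stft_eq_hft]
        _ = _ := by
            rw [lintegral_const_mul' _ _ (ENNReal.mul_ne_top ENNReal.ofReal_ne_top
              (decayWeight_ne_top _))]
            ring
    refine (lintegral_mono hx').trans ?_
    have hmeas : Measurable fun a : Rn n => decayWeight (a - x) :=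
      measurable_decayWeight.comp (by fun_prop)
    rw [lintegral_const_mul _ hmeas, lintegral_sub_right_eq_self]
    apply le_of_eq
    ring
  have hWint : ∫⁻ ξ, W ξ = (∫⁻ η : Rn n, decayWeight η) * sjNorm hbar g₀ f := by
    rw [hW, lintegral_lintegral_swap]
    · rw [← lintegral_mul_const _ measurable_decayWeight]
      refine lintegral_congr fun η => ?_
      rw [lintegral_const_mul' _ _ (decayWeight_ne_top η),
        lintegral_sub_right_eq_self]
      rfl
    · refine Measurable.aemeasurable ?_
      exact (measurable_decayWeight.comp measurable_snd).mul
        (hSm.comp (by fun_prop))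
  have hfin : ‖D‖ₑ * sjNorm hbar g f ≤ ENNReal.ofReal A * (∫⁻ u : Rn n, decayWeight u) *
      ((∫⁻ η : Rn n, decayWeight η) * sjNorm hbar g₀ f) := by
    rw [sjNorm, ← lintegral_const_mul' _ _ enorm_ne_top, ← hWint, ← lintegral_const_mul']
    · refine lintegral_mono fun ξ => ?_
      rw [ENNReal.mul_iSup]
      exact iSup_le fun x => hpt x ξ
    · exact ENNReal.mul_ne_top ENNReal.ofReal_ne_top lintegral_decayWeight_lt_top.ne
  have htop : ENNReal.ofReal A * (∫⁻ u : Rn n, decayWeight u) *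
      ((∫⁻ η : Rn n, decayWeight η) * sjNorm hbar g₀ f) < ∞ :=
    ENNReal.mul_lt_top (ENNReal.mul_lt_top ENNReal.ofReal_lt_top lintegral_decayWeight_lt_top)
      (ENNReal.mul_lt_top lintegral_decayWeight_lt_top hN)
  by_contra h
  rw [not_lt, top_le_iff] at h
  rw [h, ENNReal.mul_top (by simpa using hD0)] at hfin
  exact absurd hfin (not_le.2 htop)

end WindowChange

open scoped FourierTransform

/-! ### Fresnel integrals through the Gabor transform -/

section FresnelIntegral

variable {n : ℕ}

/-- The Gabor transform without its normalization. -/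
def gab (hbar : ℝ) (g F : Rn n → ℂ) (x ξ : Rn n) : ℂ :=
  hft hbar (fun y => F y * (starRingEnd ℂ) (g (y - x))) ξ

lemma enorm_const_mul_lintegral_gab (hbar : ℝ) (g F : Rn n → ℂ) :
    ‖(((2 * Real.pi * hbar) ^ (-(n : ℝ) / 2) : ℝ) : ℂ)‖ₑ * ∫⁻ ξ, ⨆ x, ‖gab hbar g F x ξ‖ₑ =
      sjNorm hbar g F := by
  rw [← lintegral_const_mul' _ _ enorm_ne_top, sjNorm]
  refine lintegral_congr fun ξ => ?_
  rw [ENNReal.mul_iSup]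
  simp only [stft_eq_hft, enorm_mul, gab]

variable {F : Rn n → ℂ} {B : ℝ}

/-- The substitution t = y - x frees the window from `x`, so that B‖g(t)‖ dominates for all points
at once. -/
lemma continuous_gab (hbar : ℝ) (hF : Continuous F) (hB : ∀ x, ‖F x‖ ≤ B) (g : 𝓢(Rn n, ℂ)) :
    Continuous fun p : Rn n × Rn n => gab hbar g F p.1 p.2 := by
  have e : ∀ p : Rn n × Rn n, gab hbar g F p.1 p.2 =
      ∫ t, Complex.exp (-(Complex.I / (hbar : ℂ)) * ((inner ℝ p.2 (t + p.1) : ℝ) : ℂ)) *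
        (F (t + p.1) * (starRingEnd ℂ) (g t)) := by
    intro p
    rw [gab, hft, ← integral_add_right_eq_self _ p.1]
    simp only [add_sub_cancel_right]
  simp_rw [e]
  have hg := g.continuous
  refine continuous_of_dominated (bound := fun t => B * ‖g t‖)
    (fun p => Continuous.aestronglyMeasurable (by fun_prop))
    (fun p => .of_forall fun t => ?_) (g.integrable.norm.const_mul B) (.of_forall fun t => ?_)
  · rw [norm_mul, norm_cexp_phase, one_mul, norm_mul, RCLike.norm_conj]
    gcongr
    exact hB _
  · fun_prop

lemma measurable_iSup_gab (hbar : ℝ) (hF : Continuous F) (hB : ∀ x, ‖F x‖ ≤ B)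
    (g : 𝓢(Rn n, ℂ)) : Measurable fun ξ : Rn n => ⨆ x : Rn n, ‖gab hbar g F x ξ‖ₑ := by
  refine (lowerSemicontinuous_iSup fun x => Continuous.lowerSemicontinuous ?_).measurable
  exact ((continuous_gab hbar hF hB g).comp (by fun_prop : Continuous fun ξ => (x, ξ))).enorm

lemma iSup_gab_lt_top (hbar : ℝ) (hB : ∀ x, ‖F x‖ ≤ B) (g : 𝓢(Rn n, ℂ)) (ξ : Rn n) :
    ⨆ x : Rn n, ‖gab hbar g F x ξ‖ₑ < ∞ := by
  have hB0 : 0 ≤ B := (norm_nonneg _).trans (hB 0)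
  refine lt_of_le_of_lt (iSup_le fun x => ?_)
    (ENNReal.ofReal_lt_top (r := B * ∫ y, ‖g y‖))
  rw [← ofReal_norm]
  refine ENNReal.ofReal_le_ofReal ((norm_hft_le _ _ _).trans ?_)
  rw [← integral_sub_right_eq_self (fun y => ‖g y‖) x, ← integral_const_mul]
  refine integral_mono_of_nonneg (.of_forall fun y => norm_nonneg _)
    ((g.integrable.norm.comp_sub_right x).const_mul B) (.of_forall fun y => ?_)
  simp only [norm_mul, RCLike.norm_conj]
  gcongr
  exact hB _

/-- Regularized oscillatory integrals in terms of the Gabor transform. -/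
lemma mul_integral_fresnel_eq {hbar : ℝ} (hF : Continuous F)
    (hB : ∀ x, ‖F x‖ ≤ B) (g φ : 𝓢(Rn n, ℂ)) :
    (∫ t, Complex.exp (-(Complex.I / (2 * (hbar : ℂ))) * ((‖t‖ ^ 2 : ℝ) : ℂ)) *
        (starRingEnd ℂ) (g t)) *
      ∫ y, Complex.exp (Complex.I / (2 * (hbar : ℂ)) * ((‖y‖ ^ 2 : ℝ) : ℂ)) * F y * φ y =
    ∫ x, Complex.exp (-(Complex.I / (2 * (hbar : ℂ))) * ((‖x‖ ^ 2 : ℝ) : ℂ)) *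
      hft hbar (fun y => F y * (starRingEnd ℂ) (g (y - x)) * φ y) (-x) := by
  simp only [hft]
  simp_rw [← integral_const_mul]
  -- Completing the square: x·y - |x|²/2 = |y|²/2 - |y - x|²/2. The last term depends only on y - x
  -- and integrates to the constant factor on the left.
  have e1 : ∀ x y : Rn n,
      Complex.exp (-(Complex.I / (2 * (hbar : ℂ))) * ((‖x‖ ^ 2 : ℝ) : ℂ)) *
        Complex.exp (-(Complex.I / (hbar : ℂ)) * ((inner ℝ (-x) y : ℝ) : ℂ)) =
      Complex.exp (Complex.I / (2 * (hbar : ℂ)) * ((‖y‖ ^ 2 : ℝ) : ℂ)) *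
        Complex.exp (-(Complex.I / (2 * (hbar : ℂ))) * ((‖y - x‖ ^ 2 : ℝ) : ℂ)) := by
    intro x y
    rw [← Complex.exp_add, ← Complex.exp_add, norm_sub_sq_real, inner_neg_left,
      real_inner_comm]
    congr 1
    push_cast
    ring
  have hI : Integrable fun y => F y * φ y := integrable_mul_schwartz hF hB φ
  have hg : Integrable fun t => (starRingEnd ℂ) (g t) := by
    exact (conjShift g 0).integrable.congr (.of_forall fun t => by simp [conjShift_apply])
  rw [integral_integral_swap]
  · refine integral_congr_ae (.of_forall fun y => ?_)
    simp only
    rw [← integral_sub_left_eq_self _ volume y, ← integral_mul_const]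
    refine integral_congr_ae (.of_forall fun x => ?_)
    simp only
    rw [← mul_assoc (Complex.exp (-(Complex.I / (2 * (hbar : ℂ))) * ((‖x‖ ^ 2 : ℝ) : ℂ))), e1]
    ring
  · have h1 := (hI.convolution_integrand (ContinuousLinearMap.mul ℝ ℂ) hg.comp_neg)
    have h2 := h1.bdd_mul (c := 1) (f := fun p : Rn n × Rn n =>
      Complex.exp (-(Complex.I / (hbar : ℂ)) * (((‖p.1‖ ^ 2 / 2 + inner ℝ (-p.1) p.2 : ℝ)) : ℂ)))
      (Continuous.aestronglyMeasurable (by fun_prop))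
      (.of_forall fun p => (norm_cexp_phase _ _).le)
    refine h2.congr (.of_forall fun p => ?_)
    simp only [Function.uncurry, ContinuousLinearMap.mul_apply', neg_sub]
    rw [← mul_assoc (Complex.exp (-(Complex.I / (2 * (hbar : ℂ))) * ((‖p.1‖ ^ 2 : ℝ) : ℂ))),
      ← Complex.exp_add]
    have : -(Complex.I / (2 * (hbar : ℂ))) * ((‖p.1‖ ^ 2 : ℝ) : ℂ) +
      -(Complex.I / (hbar : ℂ)) * ((inner ℝ (-p.1) p.2 : ℝ) : ℂ) =
      -(Complex.I / (hbar : ℂ)) * (((‖p.1‖ ^ 2 / 2 + inner ℝ (-p.1) p.2 : ℝ)) : ℂ) := by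
      push_cast; ring
    rw [this]
    ring

/-- The rescaled Schwartz function `φ(ε ·)`. -/
def dilate (φ : 𝓢(Rn n, ℂ)) {ε : ℝ} (hε : ε ≠ 0) : 𝓢(Rn n, ℂ) :=
  SchwartzMap.compCLMOfContinuousLinearEquiv ℝ
    (ContinuousLinearEquiv.smulLeft (Units.mk0 ε hε) : Rn n ≃L[ℝ] Rn n) φ

lemma dilate_apply (φ : 𝓢(Rn n, ℂ)) {ε : ℝ} (hε : ε ≠ 0) (x : Rn n) :
    dilate φ hε x = φ (ε • x) := rfl

lemma lintegral_iSup_gab_lt_top {hbar : ℝ} (hbar_pos : 0 < hbar) {g : Rn n → ℂ}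
    (hN : sjNorm hbar g F < ∞) : ∫⁻ ξ, ⨆ x, ‖gab hbar g F x ξ‖ₑ < ∞ := by
  rw [← enorm_const_mul_lintegral_gab] at hN
  have hc : (0 : ℝ) < 2 * Real.pi * hbar := by positivity
  refine lt_top_iff_ne_top.2 fun h => ?_
  rw [h, ENNReal.mul_top] at hN
  · exact lt_irrefl _ hN
  · simpa using (Real.rpow_pos_of_pos hc _).ne'

/-- After the supremum over the position argument, the integrand depends on the second variable only
through the frequency, and reflection and translation invariance give the norm. This justifies
Fubini below. -/
lemma integrable_fourier_mul_gab {hbar : ℝ} (hbar_pos : 0 < hbar) (hF : Continuous F)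
    (hB : ∀ x, ‖F x‖ ≤ B) {g : 𝓢(Rn n, ℂ)} (hN : sjNorm hbar g F < ∞) (φ : 𝓢(Rn n, ℂ)) (s : ℝ) :
    Integrable (fun p : Rn n × Rn n =>
      Complex.exp (-(Complex.I / (2 * (hbar : ℂ))) * ((‖p.2‖ ^ 2 : ℝ) : ℂ)) *
        (𝓕 φ p.1 * gab hbar g F p.2 (-p.2 - s • p.1))) (volume.prod volume) := by
  have hφ := (𝓕 φ : 𝓢(Rn n, ℂ)).continuous
  have hT := continuous_gab hbar hF hB g
  have hc : Continuous (fun p : Rn n × Rn n =>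
      Complex.exp (-(Complex.I / (2 * (hbar : ℂ))) * ((‖p.2‖ ^ 2 : ℝ) : ℂ)) *
        (𝓕 φ p.1 * gab hbar g F p.2 (-p.2 - s • p.1))) := by
    have := hT.comp (by fun_prop : Continuous fun p : Rn n × Rn n => (p.2, -p.2 - s • p.1))
    have h' := hφ.comp (continuous_fst : Continuous (Prod.fst : Rn n × Rn n → Rn n))
    simp only [Function.comp_def] at this h'
    fun_prop
  refine ⟨hc.aestronglyMeasurable, ?_⟩
  rw [HasFiniteIntegral, lintegral_prod _ hc.enorm.measurable.aemeasurable]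
  calc _ ≤ ∫⁻ η, ‖𝓕 φ η‖ₑ * ∫⁻ ξ, ⨆ x, ‖gab hbar g F x ξ‖ₑ := by
        refine lintegral_mono fun η => ?_
        have h1 : ∫⁻ x : Rn n, (⨆ x', ‖gab hbar g F x' (-x - s • η)‖ₑ) =
            ∫⁻ ξ, ⨆ x, ‖gab hbar g F x ξ‖ₑ := by
          rw [← lintegral_neg_eq_self (μ := (volume : Measure (Rn n)))]
          simp only [neg_neg]
          exact lintegral_sub_right_eq_self (fun ξ => ⨆ x', ‖gab hbar g F x' ξ‖ₑ) (s • η)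
        rw [← h1, ← lintegral_const_mul' _ _ enorm_ne_top]
        refine lintegral_mono fun x => ?_
        rw [enorm_mul, enorm_mul]
        have : ‖Complex.exp (-(Complex.I / (2 * (hbar : ℂ))) * ((‖x‖ ^ 2 : ℝ) : ℂ))‖ₑ = 1 := by
          rw [← ofReal_norm, neg_mul, Complex.exp_neg, norm_inv, norm_cexp_phase_sq]; simp
        rw [this, one_mul]
        gcongr
        exact le_iSup (fun x' => ‖gab hbar g F x' (-x - s • η)‖ₑ) x
    _ < ∞ := by
        rw [lintegral_mul_const' _ _ (lintegral_iSup_gab_lt_top hbar_pos hN).ne]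
        exact ENNReal.mul_lt_top (𝓕 φ : 𝓢(Rn n, ℂ)).integrable.2
          (lintegral_iSup_gab_lt_top hbar_pos hN)

lemma integral_fourier_schwartz (φ : 𝓢(Rn n, ℂ)) : ∫ η, 𝓕 φ η = φ 0 := by
  simpa using (schwartz_apply_eq_integral_fourier φ one_pos 0).symm

/-- The regularized oscillatory integrals of a function in the Sjöstrand class converge. -/
lemma tendsto_mul_integral_fresnel {hbar : ℝ} (hbar_pos : 0 < hbar) (hF : Continuous F)
    (hB : ∀ x, ‖F x‖ ≤ B) {g : 𝓢(Rn n, ℂ)} (hN : sjNorm hbar g F < ∞) {φ : 𝓢(Rn n, ℂ)}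
    (hφ : φ 0 = 1) :
    Tendsto (fun ε : ℝ =>
      (∫ t, Complex.exp (-(Complex.I / (2 * (hbar : ℂ))) * ((‖t‖ ^ 2 : ℝ) : ℂ)) *
        (starRingEnd ℂ) (g t)) *
      ∫ y, Complex.exp (Complex.I / (2 * (hbar : ℂ)) * ((‖y‖ ^ 2 : ℝ) : ℂ)) * F y * φ (ε • y))
      (𝓝[>] 0) (𝓝 (∫ x, Complex.exp (-(Complex.I / (2 * (hbar : ℂ))) * ((‖x‖ ^ 2 : ℝ) : ℂ)) *
        gab hbar g F x (-x))) := by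
  -- The integrand in the variable u = x + 2πħεη. Its frequency argument is -u, free of ε, so one
  -- integrable function dominates it for all ε.
  set G : ℝ → Rn n × Rn n → ℂ := fun ε p =>
    Complex.exp (-(Complex.I / (2 * (hbar : ℂ))) *
      ((‖p.2 - (2 * Real.pi * hbar * ε) • p.1‖ ^ 2 : ℝ) : ℂ)) *
      (𝓕 φ p.1 * gab hbar g F (p.2 - (2 * Real.pi * hbar * ε) • p.1) (-p.2)) with hG
  have hφc := (𝓕 φ : 𝓢(Rn n, ℂ)).continuous
  have hT := continuous_gab hbar hF hB g
  have hGc : Continuous (fun z : ℝ × Rn n × Rn n => G z.1 z.2) := by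
    have := hT.comp (by fun_prop : Continuous fun z : ℝ × Rn n × Rn n =>
      (z.2.2 - (2 * Real.pi * hbar * z.1) • z.2.1, -z.2.2))
    have h' := hφc.comp (by fun_prop : Continuous fun z : ℝ × Rn n × Rn n => z.2.1)
    simp only [Function.comp_def] at this h'
    simp only [hG]
    fun_prop
  have hS := lintegral_iSup_gab_lt_top hbar_pos hN
  have hSm := measurable_iSup_gab hbar hF hB g
  have key : ∀ ε : ℝ, 0 < ε →
      (∫ t, Complex.exp (-(Complex.I / (2 * (hbar : ℂ))) * ((‖t‖ ^ 2 : ℝ) : ℂ)) *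
        (starRingEnd ℂ) (g t)) *
      ∫ y, Complex.exp (Complex.I / (2 * (hbar : ℂ)) * ((‖y‖ ^ 2 : ℝ) : ℂ)) * F y * φ (ε • y) =
      ∫ η, ∫ u, G ε (η, u) := by
    intro ε hε
    have h1 := mul_integral_fresnel_eq (hbar := hbar) hF hB g (dilate φ hε.ne')
    simp only [dilate_apply] at h1
    rw [h1]
    have hI : ∀ x, Integrable fun y => F y * (starRingEnd ℂ) (g (y - x)) := fun x =>
      integrable_mul_schwartz hF hB (conjShift g x)
    simp_rw [fun x ξ => hft_mul_schwartz_smul hbar_pos (hI x) φ ε ξ, ← integral_const_mul]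
    rw [integral_integral_swap]
    · refine integral_congr_ae (.of_forall fun η => ?_)
      simp only
      rw [← integral_sub_right_eq_self _ ((2 * Real.pi * hbar * ε) • η)]
      refine integral_congr_ae (.of_forall fun u => ?_)
      simp only [hG, gab]
      congr 4
      abel_nf
    · exact (integrable_fourier_mul_gab hbar_pos hF hB hN φ (2 * Real.pi * hbar * ε)).swap
  have hbound : ∀ ε p, ‖G ε p‖ ≤ ‖𝓕 φ p.1‖ * (⨆ x, ‖gab hbar g F x (-p.2)‖ₑ).toReal := by
    intro ε p
    simp only [hG, norm_mul]
    have : ‖Complex.exp (-(Complex.I / (2 * (hbar : ℂ))) *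
      ((‖p.2 - (2 * Real.pi * hbar * ε) • p.1‖ ^ 2 : ℝ) : ℂ))‖ = 1 := by
      rw [neg_mul, Complex.exp_neg, norm_inv, norm_cexp_phase_sq, inv_one]
    rw [this, one_mul]
    gcongr
    rw [← toReal_enorm]
    exact ENNReal.toReal_mono (iSup_gab_lt_top hbar hB g _).ne
      (le_iSup (fun x => ‖gab hbar g F x (-p.2)‖ₑ) _)
  have hbi : Integrable (fun p : Rn n × Rn n =>
      ‖𝓕 φ p.1‖ * (⨆ x, ‖gab hbar g F x (-p.2)‖ₑ).toReal) (volume.prod volume) :=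
    (𝓕 φ : 𝓢(Rn n, ℂ)).integrable.norm.mul_prod
      (integrable_toReal_of_lintegral_ne_top hSm.aemeasurable hS.ne).comp_neg
  have hGi : ∀ ε, Integrable (G ε) (volume.prod volume) := fun ε =>
    hbi.mono' (hGc.comp (by fun_prop : Continuous fun p => (ε, p))).aestronglyMeasurable
      (.of_forall (hbound ε))
  have hlim : Tendsto (fun ε => ∫ p, G ε p ∂(volume.prod volume)) (𝓝[>] 0)
      (𝓝 (∫ p, G 0 p ∂(volume.prod volume))) := by
    refine tendsto_integral_filter_of_dominated_convergence _
      (.of_forall fun ε => (hGi ε).aestronglyMeasurable)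
      (.of_forall fun ε => .of_forall (hbound ε)) hbi (.of_forall fun p => ?_)
    exact ((hGc.comp (by fun_prop : Continuous fun ε : ℝ => (ε, p))).tendsto 0).mono_left
      nhdsWithin_le_nhds
  -- At ε = 0 the double integral factors, and the first factor is ∫ 𝓕 φ = φ(0) = 1; hence the limit
  -- does not depend on φ.
  have h0 : ∫ p, G 0 p ∂(volume.prod volume) =
      ∫ x, Complex.exp (-(Complex.I / (2 * (hbar : ℂ))) * ((‖x‖ ^ 2 : ℝ) : ℂ)) *
        gab hbar g F x (-x) := by
    have h2 := integral_prod_mul (μ := (volume : Measure (Rn n))) (ν := (volume : Measure (Rn n)))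
      (fun η => 𝓕 φ η) (fun x : Rn n =>
        Complex.exp (-(Complex.I / (2 * (hbar : ℂ))) * ((‖x‖ ^ 2 : ℝ) : ℂ)) *
        gab hbar g F x (-x))
    rw [integral_fourier_schwartz, hφ, one_mul] at h2
    rw [← h2]
    refine integral_congr_ae (.of_forall fun p => ?_)
    simp only [hG, mul_zero, zero_smul, sub_zero]
    ring
  rw [h0] at hlim
  refine hlim.congr' ?_
  filter_upwards [self_mem_nhdsWithin] with ε hε
  rw [key ε hε, integral_prod _ (hGi ε)]

lemma enorm_integral_gab_le (hbar : ℝ) (g F : Rn n → ℂ) :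
    ‖∫ x, Complex.exp (-(Complex.I / (2 * (hbar : ℂ))) * ((‖x‖ ^ 2 : ℝ) : ℂ)) *
        gab hbar g F x (-x)‖ₑ ≤ ∫⁻ ξ, ⨆ x, ‖gab hbar g F x ξ‖ₑ := by
  refine (enorm_integral_le_lintegral_enorm _).trans ?_
  rw [← lintegral_neg_eq_self (fun ξ => ⨆ x, ‖gab hbar g F x ξ‖ₑ)]
  refine lintegral_mono fun x => ?_
  have : ‖Complex.exp (-(Complex.I / (2 * (hbar : ℂ))) * ((‖x‖ ^ 2 : ℝ) : ℂ))‖ₑ = 1 := by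
    rw [← ofReal_norm, neg_mul, Complex.exp_neg, norm_inv, norm_cexp_phase_sq]; simp
  rw [enorm_mul, this, one_mul]
  exact le_iSup (fun x' => ‖gab hbar g F x' (-x)‖ₑ) x

end FresnelIntegral

/-! ### Gaussian windows: dimension-free bounds for the functionals -/

section Window

variable {hbar : ℝ} {q : ℕ → ℝ} {n : ℕ} {F : Rn n → ℂ}

lemma conj_window (x : Rn n) : (starRingEnd ℂ) (window hbar q n x) = window hbar q n x := by
  simp only [window, Complex.conj_ofReal]

lemma window_zero : window hbar q n 0 = (((2 * Real.pi * hbar) ^ (-(n : ℝ) / 2) : ℝ) : ℂ) := by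
  simp [window]

lemma continuous_window : Continuous (window hbar q n) := by
  unfold window; fun_prop

lemma integrable_mul_conj_window (hbar_pos : 0 < hbar) (q_pos : ∀ j, 0 < q j)
    (hF : Continuous F) {B : ℝ} (hB : ∀ x, ‖F x‖ ≤ B) (x : Rn n) :
    Integrable fun y => F y * (starRingEnd ℂ) (window hbar q n (y - x)) := by
  rw [← windowS_coe hbar hbar_pos q q_pos]
  exact integrable_mul_schwartz hF hB (conjShift _ x)

/-- The Sjöstrand class is determined by the Gaussian window. -/
lemma mem_sjostrand_iff (hbar_pos : 0 < hbar) (q_pos : ∀ j, 0 < q j) :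
    F ∈ sjostrand hbar n ↔
      Continuous F ∧ (∃ B, ∀ x, ‖F x‖ ≤ B) ∧ sjNorm hbar (window hbar q n) F < ∞ := by
  constructor
  · rintro ⟨hF, hφ, g, hg, hN⟩
    obtain ⟨B, hB⟩ := exists_norm_le_of_sjNorm_lt_top hbar_pos hF hφ hg hN
    refine ⟨hF, ⟨B, hB⟩, ?_⟩
    rw [← windowS_coe hbar hbar_pos q q_pos]
    exact sjNorm_lt_top_of_window hbar_pos hg hF hB hN
  · rintro ⟨hF, ⟨B, hB⟩, hN⟩
    refine ⟨hF, integrable_mul_schwartz hF hB, windowS hbar hbar_pos q q_pos n, ?_, ?_⟩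
    · intro h
      have h0 : windowS hbar hbar_pos q q_pos n 0 = 0 := by rw [h]; rfl
      rw [windowS_coe, window_zero, Complex.ofReal_eq_zero] at h0
      exact (Real.rpow_pos_of_pos (by positivity) _).ne' h0
    · rwa [windowS_coe]

/-- The Gaussian-window norm dominates the supremum norm, uniformly in the dimension. -/
lemma enorm_le_sjNorm_window (hbar_pos : 0 < hbar) (q_pos : ∀ j, 0 < q j) (hF : Continuous F)
    {B : ℝ} (hB : ∀ x, ‖F x‖ ≤ B) (x : Rn n) :
    ‖F x‖ₑ ≤ sjNorm hbar (window hbar q n) F := by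
  refine le_trans (le_of_eq ?_) (enorm_mul_le_sjNorm hbar_pos hF continuous_window
    (integrable_mul_conj_window hbar_pos q_pos hF hB x) x)
  have hc : (0 : ℝ) < 2 * Real.pi * hbar := by positivity
  rw [sub_self, window_zero, ← ofReal_norm (((2 * Real.pi * hbar) ^ (-(n : ℝ) / 2) : ℝ) : ℂ),
    Complex.norm_real, Real.norm_of_nonneg (by positivity), mul_left_comm,
    ← ENNReal.ofReal_mul (by positivity), ← Real.rpow_add hc]
  simp [neg_div]

/-- The integral is a product of one-dimensional Gaussian integrals of modulus (1 + q_j²)^{-1/4},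
since (2πħ)^{-1/2} in the window cancels the remaining constant. Each factor is at least exp(-q_j²),
a crude bound that suffices. -/
lemma norm_integral_phase_mul_window_ge (hbar_pos : 0 < hbar) (q_pos : ∀ j, 0 < q j) :
    Real.exp (-∑ j : Fin n, q j ^ 2) ≤
      ‖∫ t, Complex.exp (-(Complex.I / (2 * (hbar : ℂ))) * ((‖t‖ ^ 2 : ℝ) : ℂ)) *
        (starRingEnd ℂ) (window hbar q n t)‖ := by
  have hc : (0 : ℝ) < 2 * Real.pi * hbar := by positivity
  -- The coefficient of -t_j² in the combined exponent of phase and window.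
  set b : Fin n → ℂ := fun j => (q j + Complex.I) / (2 * hbar) with hb
  have hbre : ∀ j, 0 < (b j).re := fun j => by
    have : b j = ((q j / (2 * hbar) : ℝ) : ℂ) + ((1 / (2 * hbar) : ℝ) : ℂ) * Complex.I := by
      simp only [hb]; push_cast; ring
    have e : (b j).re = q j / (2 * hbar) := by
      rw [this, Complex.add_re, Complex.ofReal_re, Complex.re_ofReal_mul, Complex.I_re, mul_zero,
        add_zero]
    rw [e]
    exact div_pos (q_pos j) (by positivity)
  have h1 : ∫ t, Complex.exp (-(Complex.I / (2 * (hbar : ℂ))) * ((‖t‖ ^ 2 : ℝ) : ℂ)) *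
        (starRingEnd ℂ) (window hbar q n t) =
      (((2 * Real.pi * hbar) ^ (-(n : ℝ) / 2) : ℝ) : ℂ) *
        ∏ j, ((Real.pi : ℂ) / b j) ^ (1 / 2 : ℂ) := by
    have h2 := GaussianFourier.integral_cexp_neg_sum_mul_add hbre 0
    simp only [Pi.zero_apply, zero_mul, Finset.sum_const_zero, add_zero, ne_eq, OfNat.ofNat_ne_zero,
      not_false_eq_true, zero_pow, zero_div, Complex.exp_zero, mul_one] at h2
    rw [← h2, ← (PiLp.volume_preserving_toLp (Fin n)).integral_comp
      (MeasurableEquiv.toLp 2 _).measurableEmbedding, ← integral_const_mul]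
    refine integral_congr_ae (.of_forall fun v => ?_)
    beta_reduce
    rw [conj_window]
    simp only [window, EuclideanSpace.norm_sq_eq, Real.norm_eq_abs, sq_abs]
    rw [Complex.ofReal_mul, mul_left_comm, Complex.ofReal_exp, ← Complex.exp_add]
    congr 2
    push_cast
    rw [Finset.mul_sum, Finset.mul_sum, ← Finset.sum_add_distrib, ← Finset.sum_neg_distrib]
    refine Finset.sum_congr rfl fun j _ => ?_
    simp only [hb]
    ring
  rw [h1, norm_mul, norm_prod, Complex.norm_real, Real.norm_of_nonneg (by positivity)]
  have h3 : (2 * Real.pi * hbar) ^ (-(n : ℝ) / 2) =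
      ∏ _j : Fin n, (2 * Real.pi * hbar) ^ (-(1 : ℝ) / 2) := by
    rw [Finset.prod_const, Finset.card_univ, Fintype.card_fin, ← Real.rpow_natCast,
      ← Real.rpow_mul hc.le]
    congr 1; ring
  rw [h3, ← Finset.prod_mul_distrib, ← Finset.sum_neg_distrib, Real.exp_sum]
  refine Finset.prod_le_prod (fun j _ => by positivity) fun j _ => ?_
  have hz : (Real.pi : ℂ) / b j ≠ 0 := by
    refine div_ne_zero (by exact_mod_cast Real.pi_pos.ne') fun h => ?_
    have := hbre j
    rw [h] at this
    simp at this
  have hn2 : ‖((Real.pi : ℂ) / b j) ^ (1 / 2 : ℂ)‖ = ‖(Real.pi : ℂ) / b j‖ ^ (1 / 2 : ℝ) := by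
    have := Complex.norm_cpow_of_ne_zero hz (1 / 2 : ℂ)
    rw [this]
    simp
  have hq1 : ‖(q j : ℂ) + Complex.I‖ ≤ Real.exp (2 * q j ^ 2) := by
    have e : ‖(q j : ℂ) + Complex.I‖ = √(q j ^ 2 + 1) := by
      have := Complex.norm_add_mul_I (q j) 1
      simpa using this
    rw [e]
    refine (Real.sqrt_le_sqrt (y := (Real.exp (2 * q j ^ 2)) ^ 2) ?_).trans_eq
      (Real.sqrt_sq (by positivity))
    rw [← Real.exp_nat_mul]
    refine (Real.add_one_le_exp _).trans (Real.exp_le_exp.2 ?_)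
    push_cast
    nlinarith [sq_nonneg (q j)]
  have hpos : 0 < ‖(q j : ℂ) + Complex.I‖ := by
    refine norm_pos_iff.2 fun h => ?_
    have := congrArg Complex.im h
    simp at this
  have hn : ‖(Real.pi : ℂ) / b j‖ = 2 * Real.pi * hbar / ‖(q j : ℂ) + Complex.I‖ := by
    simp only [hb]
    rw [div_div_eq_mul_div, norm_div, norm_mul, norm_mul]
    simp only [Complex.norm_real, Real.norm_of_nonneg Real.pi_pos.le,
      Real.norm_of_nonneg hbar_pos.le]
    simp
    ring
  rw [hn2, hn, Real.div_rpow hc.le hpos.le, ← mul_div_assoc, ← Real.rpow_add hc]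
  norm_num
  rw [Real.exp_neg]
  refine inv_anti₀ (Real.rpow_pos_of_pos hpos _) ?_
  calc ‖(q j : ℂ) + Complex.I‖ ^ (1 / 2 : ℝ) ≤ (Real.exp (2 * q j ^ 2)) ^ (1 / 2 : ℝ) := by gcongr
    _ = Real.exp (q j ^ 2) := by
      rw [← Real.exp_mul]; congr 1; ring

lemma two_pi_I_mul_eq (hbar : ℝ) : (2 * (Real.pi : ℂ) * Complex.I * (hbar : ℂ)) =
    ((2 * Real.pi * hbar : ℝ) : ℂ) * Complex.I := by push_cast; ring

lemma two_pi_I_mul_ne_zero (hbar_pos : 0 < hbar) :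
    (2 * (Real.pi : ℂ) * Complex.I * (hbar : ℂ)) ≠ 0 := by
  have hc : (0 : ℝ) < 2 * Real.pi * hbar := by positivity
  rw [two_pi_I_mul_eq]
  exact mul_ne_zero (Complex.ofReal_ne_zero.2 hc.ne') Complex.I_ne_zero

lemma norm_fresnel_const (hbar_pos : 0 < hbar) (n : ℕ) :
    ‖(2 * (Real.pi : ℂ) * Complex.I * (hbar : ℂ)) ^ (-(n : ℂ) / 2)‖ =
      (2 * Real.pi * hbar) ^ (-(n : ℝ) / 2) := by
  have hc : (0 : ℝ) < 2 * Real.pi * hbar := by positivity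
  rw [Complex.norm_cpow_of_ne_zero (two_pi_I_mul_ne_zero hbar_pos)]
  have h1 : (-(n : ℂ) / 2).im = 0 := by simp
  have h2 : (-(n : ℂ) / 2).re = -(n : ℝ) / 2 := by simp
  rw [h1, h2, two_pi_I_mul_eq, norm_mul, Complex.norm_real, Real.norm_of_nonneg hc.le]
  simp

/-- Functions in the Sjöstrand class are Fresnel integrable, with a dimension-free bound. -/
lemma exists_hasFresnelIntegral (hbar_pos : 0 < hbar) (q_pos : ∀ j, 0 < q j)
    (hF : F ∈ sjostrand hbar n) :
    ∃ a, HasFresnelIntegral hbar F a ∧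
      ‖a‖ₑ ≤ ENNReal.ofReal (Real.exp (∑ j : Fin n, q j ^ 2)) *
        sjNorm hbar (window hbar q n) F := by
  obtain ⟨hFc, ⟨B, hB⟩, hN⟩ := (mem_sjostrand_iff hbar_pos q_pos).1 hF
  set A : ℂ := ∫ t, Complex.exp (-(Complex.I / (2 * (hbar : ℂ))) * ((‖t‖ ^ 2 : ℝ) : ℂ)) *
        (starRingEnd ℂ) (window hbar q n t) with hA
  have hAn : Real.exp (-∑ j : Fin n, q j ^ 2) ≤ ‖A‖ :=
    norm_integral_phase_mul_window_ge hbar_pos q_pos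
  have hA0 : A ≠ 0 := norm_pos_iff.1 ((Real.exp_pos _).trans_le hAn)
  have hAi : ‖A⁻¹‖ₑ ≤ ENNReal.ofReal (Real.exp (∑ j : Fin n, q j ^ 2)) := by
    rw [← ofReal_norm, norm_inv]
    refine ENNReal.ofReal_le_ofReal ?_
    rw [Real.exp_neg] at hAn
    exact inv_le_of_inv_le₀ (Real.exp_pos _) hAn
  -- The Fresnel prefactor has the modulus of the Gabor normalization, so the norm bound loses only
  -- the factor |A|⁻¹.
  refine ⟨(2 * (Real.pi : ℂ) * Complex.I * (hbar : ℂ)) ^ (-(n : ℂ) / 2) * (A⁻¹ *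
    ∫ x, Complex.exp (-(Complex.I / (2 * (hbar : ℂ))) * ((‖x‖ ^ 2 : ℝ) : ℂ)) *
        gab hbar (window hbar q n) F x (-x)), fun φ hφ => ?_, ?_⟩
  · have h := tendsto_mul_integral_fresnel hbar_pos hFc hB
      (g := windowS hbar hbar_pos q q_pos n) (by rwa [windowS_coe]) hφ
    simp only [windowS_coe] at h
    rw [← hA] at h
    refine ((h.const_mul A⁻¹).const_mul _).congr fun ε => ?_
    rw [inv_mul_cancel_left₀ hA0]
  · rw [enorm_mul, enorm_mul, mul_left_comm, ← enorm_const_mul_lintegral_gab]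
    refine mul_le_mul' hAi (mul_le_mul' (le_of_eq ?_) (enorm_integral_gab_le _ _ _))
    rw [← ofReal_norm, norm_fresnel_const hbar_pos, ← ofReal_norm, Complex.norm_real,
      Real.norm_of_nonneg (by positivity)]

/-- Without such a test function every number would be a Fresnel integral; with one, uniqueness
follows from uniqueness of limits. -/
lemma exists_schwartz_zero_eq_one (n : ℕ) : ∃ φ : 𝓢(Rn n, ℂ), φ 0 = 1 :=
  ⟨diagGaussian (fun _ => 1) (fun _ => one_ne_zero), by simp [diagGaussian_apply]⟩

lemma HasFresnelIntegral.unique {a b : ℂ} (ha : HasFresnelIntegral hbar F a)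
    (hb : HasFresnelIntegral hbar F b) : a = b := by
  obtain ⟨φ, hφ⟩ := exists_schwartz_zero_eq_one n
  exact tendsto_nhds_unique (ha φ hφ) (hb φ hφ)

lemma HasFresnelIntegral.Ln_eq {a : ℂ} (ha : HasFresnelIntegral hbar F a) : Ln hbar F = a := by
  have h : ∃ a, HasFresnelIntegral hbar F a := ⟨a, ha⟩
  rw [Ln, dif_pos h]
  exact h.choose_spec.unique ha

lemma hasFresnelIntegral_Ln (hbar_pos : 0 < hbar) (q_pos : ∀ j, 0 < q j)
    (hF : F ∈ sjostrand hbar n) : HasFresnelIntegral hbar F (Ln hbar F) := by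
  obtain ⟨a, ha, -⟩ := exists_hasFresnelIntegral hbar_pos q_pos hF
  rwa [ha.Ln_eq]

lemma enorm_Ln_le (hbar_pos : 0 < hbar) (q_pos : ∀ j, 0 < q j)
    (q_sum : Summable fun j => q j ^ 2) (hF : F ∈ sjostrand hbar n) :
    ‖Ln hbar F‖ₑ ≤ ENNReal.ofReal (Real.exp (∑' j, q j ^ 2)) *
      sjNorm hbar (window hbar q n) F := by
  obtain ⟨a, ha, hle⟩ := exists_hasFresnelIntegral hbar_pos q_pos hF
  rw [ha.Ln_eq]
  refine hle.trans ?_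
  gcongr
  rw [Fin.sum_univ_eq_sum_range (fun j => q j ^ 2)]
  exact q_sum.sum_le_tsum _ fun j _ => sq_nonneg _

lemma HasFresnelIntegral.sub {G : Rn n → ℂ} {a b : ℂ} (hFc : Continuous F) {B : ℝ}
    (hB : ∀ x, ‖F x‖ ≤ B) (hGc : Continuous G) {B' : ℝ} (hB' : ∀ x, ‖G x‖ ≤ B')
    (ha : HasFresnelIntegral hbar F a) (hb : HasFresnelIntegral hbar G b) :
    HasFresnelIntegral hbar (F - G) (a - b) := by
  intro φ hφ
  refine ((ha φ hφ).sub (hb φ hφ)).congr' ?_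
  filter_upwards [self_mem_nhdsWithin] with ε (hε : 0 < ε)
  have hI : ∀ {H : Rn n → ℂ} {C : ℝ}, Continuous H → (∀ x, ‖H x‖ ≤ C) → Integrable fun x : Rn n =>
      Complex.exp (Complex.I / (2 * (hbar : ℂ)) * ((‖x‖ ^ 2 : ℝ) : ℂ)) * H x * φ (ε • x) := by
    intro H C hH hC
    refine integrable_mul_schwartz (B := C) (by fun_prop) (fun x => ?_) (dilate φ hε.ne')
    rw [norm_mul, norm_cexp_phase_sq, one_mul]
    exact hC x
  rw [← mul_sub, ← integral_sub (hI hFc hB) (hI hGc hB')]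
  congr 2
  ext x
  simp only [Pi.sub_apply]
  ring

lemma sjNorm_window_sub_le (hbar_pos : 0 < hbar) (q_pos : ∀ j, 0 < q j) {G : Rn n → ℂ}
    (hFc : Continuous F) {B : ℝ} (hB : ∀ x, ‖F x‖ ≤ B) (hGc : Continuous G) {B' : ℝ}
    (hB' : ∀ x, ‖G x‖ ≤ B') :
    sjNorm hbar (window hbar q n) (F - G) ≤
      sjNorm hbar (window hbar q n) F + sjNorm hbar (window hbar q n) G := by
  have hF := integrable_mul_conj_window hbar_pos q_pos hFc hB
  have hG := integrable_mul_conj_window hbar_pos q_pos hGc hB'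
  simp only [sjNorm]
  rw [← lintegral_add_left (measurable_iSup_stft hbar hF)]
  refine lintegral_mono fun ξ => iSup_le fun x => ?_
  have : stft hbar (window hbar q n) (F - G) x ξ =
      stft hbar (window hbar q n) F x ξ - stft hbar (window hbar q n) G x ξ := by
    simp only [stft_eq_hft]
    rw [← mul_sub, ← hft_sub hbar (hF x) (hG x)]
    simp only [Pi.sub_apply, sub_mul]
  rw [this]
  exact (enorm_sub_le).trans (add_le_add
    (le_iSup (fun x => ‖stft hbar (window hbar q n) F x ξ‖ₑ) x)
    (le_iSup (fun x => ‖stft hbar (window hbar q n) G x ξ‖ₑ) x))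

lemma sub_mem_sjostrand (hbar_pos : 0 < hbar) (q_pos : ∀ j, 0 < q j) {G : Rn n → ℂ}
    (hF : F ∈ sjostrand hbar n) (hG : G ∈ sjostrand hbar n) : F - G ∈ sjostrand hbar n := by
  rw [mem_sjostrand_iff hbar_pos q_pos] at *
  obtain ⟨hFc, ⟨B, hB⟩, hN⟩ := hF
  obtain ⟨hGc, ⟨B', hB'⟩, hN'⟩ := hG
  exact ⟨hFc.sub hGc, ⟨B + B', fun x => (norm_sub_le _ _).trans (add_le_add (hB x) (hB' x))⟩,
    (sjNorm_window_sub_le hbar_pos q_pos hFc hB hGc hB').trans_lt (ENNReal.add_lt_top.2 ⟨hN, hN'⟩)⟩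

lemma Ln_sub (hbar_pos : 0 < hbar) (q_pos : ∀ j, 0 < q j) {G : Rn n → ℂ}
    (hF : F ∈ sjostrand hbar n) (hG : G ∈ sjostrand hbar n) :
    Ln hbar (F - G) = Ln hbar F - Ln hbar G := by
  obtain ⟨hFc, ⟨B, hB⟩, -⟩ := (mem_sjostrand_iff hbar_pos q_pos).1 hF
  obtain ⟨hGc, ⟨B', hB'⟩, -⟩ := (mem_sjostrand_iff hbar_pos q_pos).1 hG
  exact ((hasFresnelIntegral_Ln hbar_pos q_pos hF).sub hFc hB hGc hB'
    (hasFresnelIntegral_Ln hbar_pos q_pos hG)).Ln_eq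

end Window

/-! ### Splitting off the last coordinate -/

section Snoc

variable {n : ℕ}

/-- The identification of `ℝⁿ × ℝ` with `ℝⁿ⁺¹`. -/
def snocEquiv (n : ℕ) : Rn n × ℝ ≃ᵐ Rn (n + 1) :=
  ((MeasurableEquiv.toLp 2 (Fin n → ℝ)).symm.prodCongr (MeasurableEquiv.refl ℝ)).trans
    (MeasurableEquiv.prodComm.trans
      ((MeasurableEquiv.piFinSuccAbove (fun _ => ℝ) (Fin.last n)).symm.trans
        (MeasurableEquiv.toLp 2 (Fin (n + 1) → ℝ))))

/-- The point `(y, t)` of `ℝⁿ⁺¹`. -/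
def snoc (y : Rn n) (t : ℝ) : Rn (n + 1) :=
  WithLp.toLp 2 (Fin.snoc (α := fun _ => ℝ) (WithLp.ofLp y) t)

lemma snocEquiv_apply (p : Rn n × ℝ) : snocEquiv n p = snoc p.1 p.2 := by
  ext j
  change Fin.insertNth (α := fun _ => ℝ) (Fin.last n) p.2 (WithLp.ofLp p.1) j = _
  rw [Fin.insertNth_last]
  rfl

lemma measurePreserving_snocEquiv : MeasurePreserving (snocEquiv n) := by
  refine (PiLp.volume_preserving_toLp (Fin (n + 1))).comp
    (MeasurePreserving.comp (volume_preserving_piFinSuccAbove (fun _ => ℝ) (Fin.last n)).symm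
      (MeasurePreserving.comp Measure.measurePreserving_swap ?_))
  exact (PiLp.volume_preserving_ofLp (Fin n)).prod (MeasurePreserving.id _)

@[simp] lemma snoc_castSucc (y : Rn n) (t : ℝ) (j : Fin n) : snoc y t j.castSucc = y j := by
  simp [snoc]

@[simp] lemma snoc_last (y : Rn n) (t : ℝ) : snoc y t (Fin.last n) = t := by
  simp [snoc]

lemma inner_snoc (ξ y : Rn n) (τ t : ℝ) :
    inner ℝ (snoc ξ τ) (snoc y t) = inner ℝ ξ y + inner ℝ τ t := by
  simp [PiLp.inner_apply, Fin.sum_univ_castSucc]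

lemma snoc_sub (x y : Rn n) (s t : ℝ) : snoc x s - snoc y t = snoc (x - y) (s - t) := by
  ext j
  refine Fin.lastCases ?_ (fun j => ?_) j <;> simp

lemma smul_snoc (ε : ℝ) (x : Rn n) (s : ℝ) : ε • snoc x s = snoc (ε • x) (ε * s) := by
  ext j
  refine Fin.lastCases ?_ (fun j => ?_) j <;> simp

lemma norm_sq_snoc (x : Rn n) (s : ℝ) : ‖snoc x s‖ ^ 2 = ‖x‖ ^ 2 + s ^ 2 := by
  simp [EuclideanSpace.norm_sq_eq, Fin.sum_univ_castSucc]

lemma continuous_snoc : Continuous fun p : Rn n × ℝ => snoc p.1 p.2 := by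
  refine (PiLp.continuous_toLp 2 _).comp (continuous_pi fun j => ?_)
  refine Fin.lastCases ?_ (fun j => ?_) j
  · simpa using continuous_snd
  · simp only [Fin.snoc_castSucc]
    fun_prop

/-- The projection of `ℝⁿ⁺¹` to the first `n` coordinates. -/
def init (z : Rn (n + 1)) : Rn n := WithLp.toLp 2 fun j => z j.castSucc

@[simp] lemma init_snoc (y : Rn n) (t : ℝ) : init (snoc y t) = y := by
  ext j; simp [init]

lemma snoc_init (z : Rn (n + 1)) : snoc (init z) (z (Fin.last n)) = z := by
  ext j
  refine Fin.lastCases ?_ (fun j => ?_) j <;> simp [init]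

lemma continuous_init : Continuous (init : Rn (n + 1) → Rn n) := by
  unfold init; fun_prop

lemma integral_snoc (f : Rn (n + 1) → ℂ) :
    ∫ z, f z = ∫ p : Rn n × ℝ, f (snoc p.1 p.2) := by
  rw [← measurePreserving_snocEquiv.integral_comp']
  simp only [snocEquiv_apply]

lemma integrable_snoc {f : Rn (n + 1) → ℂ} (hf : Integrable f) :
    Integrable fun p : Rn n × ℝ => f (snoc p.1 p.2) := by
  have := (measurePreserving_snocEquiv (n := n)).integrable_comp_of_integrable hf
  refine this.congr (.of_forall fun p => ?_)
  simp [snocEquiv_apply]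

lemma lintegral_snoc {f : Rn (n + 1) → ℝ≥0∞} (hf : Measurable f) :
    ∫⁻ z, f z = ∫⁻ y : Rn n, ∫⁻ t : ℝ, f (snoc y t) := by
  rw [← (measurePreserving_snocEquiv (n := n)).lintegral_comp hf]
  simp only [snocEquiv_apply]
  exact lintegral_prod _ (hf.comp continuous_snoc.measurable).aemeasurable

end Snoc

/-! ### Passing between dimensions n and n + 1 -/

section Step

variable {hbar : ℝ} {q : ℕ → ℝ} {n : ℕ}

/-- The one-dimensional factor of the Gaussian window. -/
def window₁ (hbar a : ℝ) (t : ℝ) : ℂ :=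
  (((2 * Real.pi * hbar) ^ (-(1 : ℝ) / 2) * Real.exp (-(1 / (2 * hbar)) * (a * t ^ 2)) : ℝ) : ℂ)

lemma window_snoc (hbar_pos : 0 < hbar) (y : Rn n) (t : ℝ) :
    window hbar q (n + 1) (snoc y t) = window hbar q n y * window₁ hbar (q n) t := by
  have hc : (0 : ℝ) < 2 * Real.pi * hbar := by positivity
  simp only [window, window₁, Fin.sum_univ_castSucc, snoc_castSucc, snoc_last, Fin.val_castSucc,
    Fin.val_last]
  rw [mul_add, Real.exp_add]
  have : (2 * Real.pi * hbar) ^ (-((n + 1 : ℕ) : ℝ) / 2) =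
      (2 * Real.pi * hbar) ^ (-(n : ℝ) / 2) * (2 * Real.pi * hbar) ^ (-(1 : ℝ) / 2) := by
    rw [← Real.rpow_add hc]; congr 1; push_cast; ring
  rw [this]
  push_cast
  ring

lemma continuous_window₁ (a : ℝ) : Continuous (window₁ hbar a) := by
  unfold window₁; fun_prop

lemma integrable_window₁ (hbar_pos : 0 < hbar) {a : ℝ} (ha : 0 < a) :
    Integrable (window₁ hbar a) := by
  have := ((integrable_exp_neg_mul_sq (b := a / (2 * hbar)) (by positivity)).const_mul
    ((2 * Real.pi * hbar) ^ (-(1 : ℝ) / 2))).ofReal (𝕜 := ℂ)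
  refine this.congr (.of_forall fun t => ?_)
  simp only [window₁]
  congr 3
  ring

lemma norm_hft_comp_sub {E : Type*} [NormedAddCommGroup E] [InnerProductSpace ℝ E]
    [FiniteDimensional ℝ E] [MeasurableSpace E] [BorelSpace E] (h : E → ℂ) (a ξ : E) :
    ‖hft hbar (fun y => h (y - a)) ξ‖ = ‖hft hbar h ξ‖ := by
  rw [hft_eq_fourier, hft_eq_fourier, norm_fourier_comp_sub]

lemma norm_hft_window₁ (hbar_pos : 0 < hbar) {a : ℝ} (ha : 0 < a) (τ : ℝ) :
    ‖hft hbar (window₁ hbar a) τ‖ = (√a)⁻¹ * Real.exp (-(1 / (2 * hbar * a)) * τ ^ 2) := by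
  have hc : (0 : ℝ) < 2 * Real.pi * hbar := by positivity
  have hb : (0 : ℝ) < a / (2 * hbar) := by positivity
  have h := fourierIntegral_gaussian (b := ((a / (2 * hbar) : ℝ) : ℂ)) (by rw [Complex.ofReal_re]; exact hb)
    ((-(τ / hbar) : ℝ) : ℂ)
  have e : hft hbar (window₁ hbar a) τ = (((2 * Real.pi * hbar) ^ (-(1 : ℝ) / 2) : ℝ) : ℂ) *
      ∫ x : ℝ, Complex.exp (Complex.I * ((-(τ / hbar) : ℝ) : ℂ) * x) *
        Complex.exp (-((a / (2 * hbar) : ℝ) : ℂ) * (x : ℂ) ^ 2) := by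
    rw [hft, ← integral_const_mul]
    refine integral_congr_ae (.of_forall fun x => ?_)
    simp only [window₁]
    rw [Complex.ofReal_mul, mul_left_comm, Complex.ofReal_exp]
    congr 3
    · simp; ring
    · push_cast; ring
  rw [e, h, norm_mul, norm_mul, Complex.norm_real, Real.norm_of_nonneg (by positivity)]
  have e1 : -((-(τ / hbar) : ℝ) : ℂ) ^ 2 / (4 * ((a / (2 * hbar) : ℝ) : ℂ)) =
      ((-(1 / (2 * hbar * a)) * τ ^ 2 : ℝ) : ℂ) := by
    have h1 : (hbar : ℂ) ≠ 0 := Complex.ofReal_ne_zero.2 hbar_pos.ne'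
    have h2 : (a : ℂ) ≠ 0 := Complex.ofReal_ne_zero.2 ha.ne'
    push_cast
    field_simp
    ring
  have e2 : ((Real.pi : ℂ) / ((a / (2 * hbar) : ℝ) : ℂ)) ^ (1 / 2 : ℂ) =
      (((2 * Real.pi * hbar / a) ^ (1 / 2 : ℝ) : ℝ) : ℂ) := by
    rw [Complex.ofReal_cpow (by positivity)]
    congr 1
    · have h1 : (hbar : ℂ) ≠ 0 := Complex.ofReal_ne_zero.2 hbar_pos.ne'
      have h2 : (a : ℂ) ≠ 0 := Complex.ofReal_ne_zero.2 ha.ne'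
      push_cast
      field_simp
    · norm_num
  rw [e1, e2, ← Complex.ofReal_exp, Complex.norm_real, Complex.norm_real,
    Real.norm_of_nonneg (by positivity), Real.norm_of_nonneg (by positivity), ← mul_assoc]
  congr 1
  rw [Real.div_rpow hc.le ha.le, ← mul_div_assoc, ← Real.rpow_add hc, ← Real.sqrt_eq_rpow a]
  norm_num

/-- The width `a` drops out: the height a^{-1/2} of the transformed Gaussian compensates its width.
Thus a dummy variable costs no factor, whatever q is. -/
lemma lintegral_hft_window₁ (hbar_pos : 0 < hbar) {a : ℝ} (ha : 0 < a) :
    ∫⁻ τ, ‖hft hbar (window₁ hbar a) τ‖ₑ =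
      ENNReal.ofReal ((2 * Real.pi * hbar) ^ ((1 : ℝ) / 2)) := by
  have hc : (0 : ℝ) < 2 * Real.pi * hbar := by positivity
  simp only [← ofReal_norm, norm_hft_window₁ hbar_pos ha]
  rw [← ofReal_integral_eq_lintegral_ofReal
    ((integrable_exp_neg_mul_sq (b := 1 / (2 * hbar * a)) (by positivity)).const_mul _)
    (.of_forall fun τ => by positivity), integral_const_mul, integral_gaussian]
  congr 1
  rw [← Real.sqrt_eq_rpow]
  have : Real.pi / (1 / (2 * hbar * a)) = 2 * Real.pi * hbar * a := by field_simp
  rw [this, Real.sqrt_mul hc.le]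
  have := (Real.sqrt_pos.2 ha).ne'
  field_simp

variable {F : Rn (n + 1) → ℂ} {B : ℝ}

/-- Fubini for the Gabor transform. -/
lemma gab_snoc (hbar_pos : 0 < hbar) (q_pos : ∀ j, 0 < q j) (hF : Continuous F)
    (hB : ∀ x, ‖F x‖ ≤ B) (x ξ : Rn n) (s τ : ℝ) :
    gab hbar (window hbar q (n + 1)) F (snoc x s) (snoc ξ τ) =
      hft hbar (fun t : ℝ => gab hbar (window hbar q n) (fun y => F (snoc y t)) x ξ *
        window₁ hbar (q n) (t - s)) τ := by
  have hI := integrable_phase_mul hbar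
    (integrable_mul_conj_window hbar_pos q_pos hF hB (snoc x s)) (snoc ξ τ)
  rw [gab, hft, integral_snoc]
  have hI' := integrable_snoc hI
  rw [Measure.volume_eq_prod] at hI' ⊢
  rw [integral_prod_symm _ hI', hft]
  refine integral_congr_ae (.of_forall fun t => ?_)
  simp only [gab, hft]
  rw [← mul_assoc, mul_right_comm, ← integral_const_mul]
  refine integral_congr_ae (.of_forall fun y => ?_)
  beta_reduce
  rw [snoc_sub, conj_window, conj_window, window_snoc hbar_pos, inner_snoc, Complex.ofReal_add, mul_add, Complex.exp_add]
  ring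

/-- Setting the last variable to zero does not increase the norm. -/
lemma sjNorm_snoc_zero_le (hbar_pos : 0 < hbar) (q_pos : ∀ j, 0 < q j) (hF : Continuous F)
    (hB : ∀ x, ‖F x‖ ≤ B) :
    sjNorm hbar (window hbar q n) (fun y => F (snoc y 0)) ≤
      sjNorm hbar (window hbar q (n + 1)) F := by
  have hc : (0 : ℝ) < 2 * Real.pi * hbar := by positivity
  rw [sjNorm, sjNorm, lintegral_snoc (measurable_iSup_stft hbar
    (integrable_mul_conj_window hbar_pos q_pos hF hB))]
  refine lintegral_mono fun ξ => iSup_le fun x => ?_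
  have hcont : Continuous fun t : ℝ =>
      gab hbar (window hbar q n) (fun y => F (snoc y t)) x ξ := by
    have hw' : ∀ y, conjShift (windowS hbar hbar_pos q q_pos n) x y =
        (starRingEnd ℂ) (window hbar q n (y - x)) := fun y => by
      rw [conjShift_apply, windowS_coe]
    simp only [gab, hft, ← hw']
    have hwc := (conjShift (windowS hbar hbar_pos q q_pos n) x).continuous
    have hFc : Continuous fun p : ℝ × Rn n => F (snoc p.2 p.1) :=
      hF.comp (continuous_snoc.comp continuous_swap)
    refine continuous_of_dominated
      (bound := fun y => B * ‖conjShift (windowS hbar hbar_pos q q_pos n) x y‖)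
      (fun t => Continuous.aestronglyMeasurable ?_) (fun t => .of_forall fun y => ?_)
      ((conjShift (windowS hbar hbar_pos q q_pos n) x).integrable.norm.const_mul B)
      (.of_forall fun y => ?_)
    · have := hFc.comp (by fun_prop : Continuous fun y : Rn n => (t, y))
      exact (by fun_prop : Continuous fun y : Rn n => Complex.exp (-(Complex.I / (hbar : ℂ)) *
        ((inner ℝ ξ y : ℝ) : ℂ))).mul (this.mul hwc)
    · rw [norm_mul, norm_cexp_phase, one_mul, norm_mul]
      gcongr
      exact hB _
    · have := hFc.comp (by fun_prop : Continuous fun t : ℝ => (t, y))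
      exact continuous_const.mul (this.mul continuous_const)
  set H : ℝ → ℂ := fun t => gab hbar (window hbar q n) (fun y => F (snoc y t)) x ξ *
    window₁ hbar (q n) (t - 0) with hH
  have hw₁ : Integrable fun t => window₁ hbar (q n) (t - 0) := by
    simpa using integrable_window₁ hbar_pos (q_pos n)
  have hHc : Continuous H :=
    hcont.mul ((continuous_window₁ (q n)).comp (continuous_id.sub continuous_const))
  have hHi : Integrable H := by
    have hw := (integrable_mul_conj_window hbar_pos q_pos (n := n) (F := fun _ => (1 : ℂ))
      continuous_const (B := 1) (by simp) x)
    refine hw₁.bdd_mul (c := ∫ y, B * ‖(1 : ℂ) * (starRingEnd ℂ) (window hbar q n (y - x))‖)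
      hcont.aestronglyMeasurable (.of_forall fun t => ?_)
    refine (norm_hft_le _ _ _).trans (integral_mono_of_nonneg
      (.of_forall fun y => norm_nonneg _) (hw.norm.const_mul B) (.of_forall fun y => ?_))
    simp only [norm_mul, one_mul]
    gcongr
    exact hB _
  -- Fourier inversion in the last variable at t = 0, with the window there centered at 0. The
  -- constants match exactly: -(n+1)/2 + 1 - 1/2 = -n/2 as exponents of 2πħ.
  have h := enorm_le_lintegral_hft hbar_pos hHc hHi 0
  simp only [hH, ← gab_snoc hbar_pos q_pos hF hB] at h
  rw [Module.finrank_self, pow_one, sub_self, enorm_mul] at h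
  have h₁ : ‖window₁ hbar (q n) 0‖ₑ = ENNReal.ofReal ((2 * Real.pi * hbar) ^ (-(1 : ℝ) / 2)) := by
    rw [← ofReal_norm, window₁, Complex.norm_real]
    simp [abs_of_pos (Real.rpow_pos_of_pos hc _)]
  have hconst : ∀ m : ℕ, ‖(((2 * Real.pi * hbar) ^ (-(m : ℝ) / 2) : ℝ) : ℂ)‖ₑ =
      ENNReal.ofReal ((2 * Real.pi * hbar) ^ (-(m : ℝ) / 2)) := fun m => by
    rw [← ofReal_norm, Complex.norm_real, Real.norm_of_nonneg (by positivity)]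
  calc ‖stft hbar (window hbar q n) (fun y => F (snoc y 0)) x ξ‖ₑ
      = ‖(((2 * Real.pi * hbar) ^ (-((n + 1 : ℕ) : ℝ) / 2) : ℝ) : ℂ)‖ₑ *
        (ENNReal.ofReal (2 * Real.pi * hbar) *
          (‖gab hbar (window hbar q n) (fun y => F (snoc y 0)) x ξ‖ₑ *
            ‖window₁ hbar (q n) 0‖ₑ)) := by
        rw [stft_eq_hft, enorm_mul, hconst, hconst, h₁, mul_left_comm (ENNReal.ofReal _) ‖_‖ₑ,
          mul_left_comm (ENNReal.ofReal _) ‖_‖ₑ, ← ENNReal.ofReal_mul hc.le,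
          ← ENNReal.ofReal_mul (by positivity), mul_comm]
        congr 2
        nth_rewrite 3 [← Real.rpow_one (2 * Real.pi * hbar)]
        rw [← Real.rpow_add hc, ← Real.rpow_add hc]
        congr 1
        push_cast
        ring
    _ ≤ ‖(((2 * Real.pi * hbar) ^ (-((n + 1 : ℕ) : ℝ) / 2) : ℝ) : ℂ)‖ₑ *
        ∫⁻ τ : ℝ, ‖gab hbar (window hbar q (n + 1)) F (snoc x 0) (snoc ξ τ)‖ₑ := by gcongr
    _ = ∫⁻ τ : ℝ, ‖stft hbar (window hbar q (n + 1)) F (snoc x 0) (snoc ξ τ)‖ₑ := by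
        rw [← lintegral_const_mul' _ _ enorm_ne_top]
        simp only [stft_eq_hft, enorm_mul, gab]
    _ ≤ _ := lintegral_mono fun τ =>
        le_iSup (fun z => ‖stft hbar (window hbar q (n + 1)) F z (snoc ξ τ)‖ₑ) (snoc x 0)

variable {G : Rn n → ℂ}

/-- Adding a dummy variable does not increase the norm. -/
lemma sjNorm_comp_init_le (hbar_pos : 0 < hbar) (q_pos : ∀ j, 0 < q j) (hG : Continuous G)
    (hB : ∀ x, ‖G x‖ ≤ B) :
    sjNorm hbar (window hbar q (n + 1)) (fun z => G (init z)) ≤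
      sjNorm hbar (window hbar q n) G := by
  have hc : (0 : ℝ) < 2 * Real.pi * hbar := by positivity
  have hGi : Continuous fun z : Rn (n + 1) => G (init z) := hG.comp continuous_init
  have hBi : ∀ z : Rn (n + 1), ‖G (init z)‖ ≤ B := fun z => hB _
  rw [sjNorm, lintegral_snoc (measurable_iSup_stft hbar
    (integrable_mul_conj_window hbar_pos q_pos hGi hBi))]
  refine lintegral_mono fun ξ => ?_
  set S := ⨆ x, ‖stft hbar (window hbar q n) G x ξ‖ₑ with hS
  set κ : ℝ≥0∞ := ENNReal.ofReal ((2 * Real.pi * hbar) ^ (-(1 : ℝ) / 2)) with hκ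
  calc _ ≤ ∫⁻ τ : ℝ, κ * S * ‖hft hbar (window₁ hbar (q n)) τ‖ₑ := by
        refine lintegral_mono fun τ => iSup_le fun z => ?_
        rw [← snoc_init z, stft_eq_hft, enorm_mul]
        have h1 := gab_snoc hbar_pos q_pos hGi hBi (init z) ξ (z (Fin.last n)) τ
        rw [gab] at h1
        rw [h1]
        simp only [init_snoc]
        -- The function ignores the last variable, so its transform factors; moving the window in
        -- that variable only changes a phase.
        have h2 : hft hbar (fun t : ℝ => gab hbar (window hbar q n) (fun y => G y) (init z) ξ *
            window₁ hbar (q n) (t - z (Fin.last n))) τ =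
            gab hbar (window hbar q n) (fun y => G y) (init z) ξ *
              hft hbar (fun t : ℝ => window₁ hbar (q n) (t - z (Fin.last n))) τ := by
          simp only [hft, mul_left_comm _ (gab _ _ _ _ _)]
          exact integral_const_mul _ _
        have h3 : ‖hft hbar (fun t : ℝ => window₁ hbar (q n) (t - z (Fin.last n))) τ‖ₑ =
            ‖hft hbar (window₁ hbar (q n)) τ‖ₑ := by
          rw [← ofReal_norm, norm_hft_comp_sub, ofReal_norm]
        rw [h2, enorm_mul, h3, ← mul_assoc]
        refine mul_le_mul' ?_ le_rfl
        have h4 : ‖(((2 * Real.pi * hbar) ^ (-((n + 1 : ℕ) : ℝ) / 2) : ℝ) : ℂ)‖ₑ =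
            κ * ‖(((2 * Real.pi * hbar) ^ (-(n : ℝ) / 2) : ℝ) : ℂ)‖ₑ := by
          rw [← ofReal_norm, ← ofReal_norm, Complex.norm_real, Complex.norm_real,
            Real.norm_of_nonneg (by positivity), Real.norm_of_nonneg (by positivity), hκ,
            ← ENNReal.ofReal_mul (by positivity), ← Real.rpow_add hc]
          congr 2
          push_cast
          ring
        have h5 := stft_eq_hft hbar (window hbar q n) G (init z) ξ
        rw [h4, mul_assoc, ← enorm_mul]
        refine mul_le_mul_right ((congrArg (‖·‖ₑ) h5).ge.trans ?_) _
        exact le_iSup (fun x => ‖stft hbar (window hbar q n) G x ξ‖ₑ) (init z)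
    _ = S := by
        rw [lintegral_const_mul _ (continuous_hft hbar
          (integrable_window₁ hbar_pos (q_pos n))).enorm.measurable,
          lintegral_hft_window₁ hbar_pos (q_pos n), mul_right_comm, hκ,
          ← ENNReal.ofReal_mul (by positivity), ← Real.rpow_add hc]
        norm_num

lemma snoc_zero_mem_sjostrand (hbar_pos : 0 < hbar) (q_pos : ∀ j, 0 < q j)
    (hF : F ∈ sjostrand hbar (n + 1)) : (fun y => F (snoc y 0)) ∈ sjostrand hbar n := by
  rw [mem_sjostrand_iff hbar_pos q_pos] at hF ⊢
  obtain ⟨hFc, ⟨B, hB⟩, hN⟩ := hF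
  exact ⟨hFc.comp (continuous_snoc.comp (by fun_prop : Continuous fun y : Rn n => (y, (0 : ℝ)))),
    ⟨B, fun x => hB _⟩, (sjNorm_snoc_zero_le hbar_pos q_pos hFc hB).trans_lt hN⟩

lemma comp_init_mem_sjostrand (hbar_pos : 0 < hbar) (q_pos : ∀ j, 0 < q j)
    (hG : G ∈ sjostrand hbar n) : (fun z => G (init z)) ∈ sjostrand hbar (n + 1) := by
  rw [mem_sjostrand_iff hbar_pos q_pos] at hG ⊢
  obtain ⟨hGc, ⟨B, hB⟩, hN⟩ := hG
  exact ⟨hGc.comp continuous_init,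
    ⟨B, fun x => hB _⟩, (sjNorm_comp_init_le hbar_pos q_pos hGc hB).trans_lt hN⟩

/-- The one-dimensional Fresnel integral of 1, regularized by a Gaussian: it equals (π / (ε² -
i/2ħ))^{1/2}. The base tends to 2πiħ, off the cut of the principal branch, so the root converges to
the right one. -/
lemma tendsto_fresnel_const_one (hbar_pos : 0 < hbar) :
    Tendsto (fun ε : ℝ => (2 * (Real.pi : ℂ) * Complex.I * (hbar : ℂ)) ^ (-(1 : ℂ) / 2) *
      ∫ t : ℝ, Complex.exp (Complex.I / (2 * (hbar : ℂ)) * ((t ^ 2 : ℝ) : ℂ)) *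
        ((Real.exp (-(ε * t) ^ 2) : ℝ) : ℂ)) (𝓝[>] 0) (𝓝 1) := by
  have hh : (hbar : ℂ) ≠ 0 := Complex.ofReal_ne_zero.2 hbar_pos.ne'
  have hπ : (Real.pi : ℂ) ≠ 0 := Complex.ofReal_ne_zero.2 Real.pi_pos.ne'
  have hre : ∀ ε : ℝ, ((ε : ℂ) ^ 2 - Complex.I / (2 * hbar)).re = ε ^ 2 := by
    intro ε
    have : (ε : ℂ) ^ 2 - Complex.I / (2 * hbar) =
        ((ε ^ 2 : ℝ) : ℂ) + ((-(1 / (2 * hbar)) : ℝ) : ℂ) * Complex.I := by push_cast; ring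
    rw [this, Complex.add_re, Complex.ofReal_re, Complex.re_ofReal_mul, Complex.I_re, mul_zero,
      add_zero]
  have h0 : (Real.pi : ℂ) / (((0 : ℝ) : ℂ) ^ 2 - Complex.I / (2 * hbar)) =
      2 * (Real.pi : ℂ) * Complex.I * (hbar : ℂ) := by
    have := Complex.I_ne_zero
    field_simp
    simp
  have e := two_pi_I_mul_eq hbar
  have hc : (0 : ℝ) < 2 * Real.pi * hbar := by positivity
  have hne := two_pi_I_mul_ne_zero hbar_pos
  have hlim : Tendsto (fun ε : ℝ => (2 * (Real.pi : ℂ) * Complex.I * (hbar : ℂ)) ^ (-(1 : ℂ) / 2) *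
      ((Real.pi : ℂ) / ((ε : ℂ) ^ 2 - Complex.I / (2 * hbar))) ^ (1 / 2 : ℂ)) (𝓝 0) (𝓝 1) := by
    have h1 : ContinuousAt (fun ε : ℝ =>
        ((Real.pi : ℂ) / ((ε : ℂ) ^ 2 - Complex.I / (2 * hbar))) ^ (1 / 2 : ℂ)) 0 := by
      refine ContinuousAt.cpow ?_ continuousAt_const ?_
      · refine ContinuousAt.div continuousAt_const (by fun_prop) ?_
        simp [hbar_pos.ne']
      · rw [h0, e, Complex.mem_slitPlane_iff]
        right
        rw [Complex.im_ofReal_mul, Complex.I_im, mul_one]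
        exact hc.ne'
    have h2 := h1.tendsto.const_mul ((2 * (Real.pi : ℂ) * Complex.I * (hbar : ℂ)) ^ (-(1 : ℂ) / 2))
    rw [h0, ← Complex.cpow_add _ _ hne] at h2
    convert h2 using 2
    norm_num
  refine (hlim.mono_left nhdsWithin_le_nhds).congr' ?_
  filter_upwards [self_mem_nhdsWithin] with ε (hε : 0 < ε)
  congr 1
  have h := fourierIntegral_gaussian (b := (ε : ℂ) ^ 2 - Complex.I / (2 * hbar))
    (by rw [hre]; positivity) 0
  simp only [mul_zero, zero_mul, Complex.exp_zero, one_mul, ne_eq, OfNat.ofNat_ne_zero,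
    not_false_eq_true, zero_pow, neg_zero, zero_div, mul_one] at h
  rw [← h]
  refine integral_congr_ae (.of_forall fun t => ?_)
  simp only
  rw [Complex.ofReal_exp, ← Complex.exp_add]
  congr 1
  push_cast
  ring

/-- The Fresnel integral does not change when a dummy variable is added. -/
lemma Ln_comp_init (hbar_pos : 0 < hbar) (q_pos : ∀ j, 0 < q j) (hG : G ∈ sjostrand hbar n) :
    Ln hbar (fun z => G (init z)) = Ln hbar G := by
  have h1 := hasFresnelIntegral_Ln hbar_pos q_pos hG
  have h2 := hasFresnelIntegral_Ln hbar_pos q_pos (comp_init_mem_sjostrand hbar_pos q_pos hG)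
  -- Both Fresnel integrals are known to exist, so one test function identifies them. The Gaussian
  -- is chosen because it factors over coordinates.
  set φ : ∀ m : ℕ, 𝓢(Rn m, ℂ) := fun m => diagGaussian (fun _ => 1) (fun _ => one_ne_zero) with hφ
  have hφ0 : ∀ m, φ m 0 = 1 := fun m => by simp [hφ, diagGaussian_apply]
  have h3 := (h1 (φ n) (hφ0 n)).mul (tendsto_fresnel_const_one hbar_pos)
  rw [mul_one] at h3
  refine tendsto_nhds_unique (h2 (φ (n + 1)) (hφ0 _)) (h3.congr fun ε => ?_)
  have hne := two_pi_I_mul_ne_zero hbar_pos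
  have hexp : (-((n + 1 : ℕ) : ℂ) / 2) = -(n : ℂ) / 2 + -(1 : ℂ) / 2 := by push_cast; ring
  rw [hexp, Complex.cpow_add _ _ hne, mul_mul_mul_comm]
  congr 1
  rw [integral_snoc, Measure.volume_eq_prod, ← integral_prod_mul]
  refine integral_congr_ae (.of_forall fun p => ?_)
  simp only [init_snoc, norm_sq_snoc, smul_snoc, hφ, diagGaussian_apply, Fin.sum_univ_castSucc,
    snoc_castSucc, snoc_last, one_mul]
  rw [Complex.ofReal_add, mul_add, Complex.exp_add, neg_add, Real.exp_add, Complex.ofReal_mul]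
  ring

end Step

/-! ### Lower semicontinuity of the norm -/

section Limit

variable {hbar : ℝ} {q : ℕ → ℝ} {n : ℕ}

/-- The norm is lower semicontinuous under bounded pointwise convergence. -/
lemma sjNorm_le_of_tendsto (hbar_pos : 0 < hbar) (q_pos : ∀ j, 0 < q j) {Φ : ℕ → Rn n → ℂ}
    {F : Rn n → ℂ} {B : ℝ} {ε : ℝ≥0∞} (hc : ∀ k, Continuous (Φ k)) (hB : ∀ k x, ‖Φ k x‖ ≤ B)
    (hlim : ∀ x, Tendsto (fun k => Φ k x) atTop (𝓝 (F x)))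
    (hε : ∀ k, sjNorm hbar (window hbar q n) (Φ k) ≤ ε) :
    sjNorm hbar (window hbar q n) F ≤ ε := by
  have hI := fun k => integrable_mul_conj_window hbar_pos q_pos (hc k) (hB k)
  have hw := fun x : Rn n => integrable_mul_conj_window hbar_pos q_pos (n := n)
    (F := fun _ => (1 : ℂ)) continuous_const (B := 1) (by simp) x
  have hstft : ∀ x ξ : Rn n, Tendsto (fun k => stft hbar (window hbar q n) (Φ k) x ξ) atTop
      (𝓝 (stft hbar (window hbar q n) F x ξ)) := by
    intro x ξ
    simp only [stft_eq_hft, hft]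
    refine Tendsto.const_mul _ ?_
    refine tendsto_integral_of_dominated_convergence
      (fun y => B * ‖(1 : ℂ) * (starRingEnd ℂ) (window hbar q n (y - x))‖)
      (fun k => (integrable_phase_mul hbar (hI k x) ξ).aestronglyMeasurable)
      ((hw x).norm.const_mul B) (fun k => .of_forall fun y => ?_) (.of_forall fun y => ?_)
    · rw [norm_mul, norm_cexp_phase, one_mul, norm_mul, one_mul]
      gcongr
      exact hB k y
    · exact ((hlim y).mul_const _).const_mul _
  -- The supremum over x is lower semicontinuous under pointwise convergence of the transforms;
  -- Fatou's lemma then handles the integral over ξ.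
  calc sjNorm hbar (window hbar q n) F
      ≤ ∫⁻ ξ, liminf (fun k => ⨆ x, ‖stft hbar (window hbar q n) (Φ k) x ξ‖ₑ) atTop := by
        refine lintegral_mono fun ξ => iSup_le fun x => ?_
        rw [← (hstft x ξ).enorm.liminf_eq]
        exact liminf_le_liminf (.of_forall fun k =>
          le_iSup (fun x => ‖stft hbar (window hbar q n) (Φ k) x ξ‖ₑ) x)
    _ ≤ liminf (fun k => sjNorm hbar (window hbar q n) (Φ k)) atTop :=
        lintegral_liminf_le fun k => measurable_iSup_stft hbar (hI k)
    _ ≤ ε := by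
        refine liminf_le_of_frequently_le' (Eventually.frequently (.of_forall hε))

end Limit

/-! ### Cylinder functions, their limits, and the interchange of limits -/

section Cylinder

variable {hbar : ℝ} {q : ℕ → ℝ} {n m : ℕ}

lemma restrict_sub (n : ℕ) (f g : RInf → ℂ) : restrict n (f - g) = restrict n f - restrict n g :=
  rfl

lemma restrict_snoc_zero (f : RInf → ℂ) (y : Rn n) :
    restrict (n + 1) f (snoc y 0) = restrict n f y := by
  simp only [restrict]
  congr 1
  ext j
  rcases lt_trichotomy j n with h | rfl | h
  · rw [dif_pos (by omega), dif_pos h]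
    exact snoc_castSucc y 0 ⟨j, h⟩
  · rw [dif_pos (by omega), dif_neg (by omega)]
    exact snoc_last y 0
  · rw [dif_neg (by omega), dif_neg (by omega)]

lemma restrict_extend_succ (F : Rn m → ℂ) (h : m ≤ n) (z : Rn (n + 1)) :
    restrict (n + 1) (extend F) z = restrict n (extend F) (init z) := by
  simp only [restrict, extend]
  congr 1
  ext i
  have hi := i.2
  simp only [proj]
  rw [dif_pos (by omega), dif_pos (by omega)]
  rfl

lemma restrict_extend_self (F : Rn m → ℂ) : restrict m (extend F) = F := by
  ext x
  simp only [restrict, extend]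
  congr 1
  ext i
  simp [proj]

lemma restrict_mem_of_succ (hbar_pos : 0 < hbar) (q_pos : ∀ j, 0 < q j) {f : RInf → ℂ}
    (hf : restrict (n + 1) f ∈ sjostrand hbar (n + 1)) :
    restrict n f ∈ sjostrand hbar n ∧ sjNorm hbar (window hbar q n) (restrict n f) ≤
      sjNorm hbar (window hbar q (n + 1)) (restrict (n + 1) f) := by
  have e : restrict n f = fun y => restrict (n + 1) f (snoc y 0) :=
    funext fun y => (restrict_snoc_zero f y).symm
  rw [e]
  obtain ⟨hc, ⟨B, hB⟩, -⟩ := (mem_sjostrand_iff hbar_pos q_pos).1 hf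
  exact ⟨snoc_zero_mem_sjostrand hbar_pos q_pos hf, sjNorm_snoc_zero_le hbar_pos q_pos hc hB⟩

lemma restrict_mem_of_add (hbar_pos : 0 < hbar) (q_pos : ∀ j, 0 < q j) {f : RInf → ℂ} (k : ℕ)
    (hf : restrict (n + k) f ∈ sjostrand hbar (n + k)) :
    restrict n f ∈ sjostrand hbar n ∧ sjNorm hbar (window hbar q n) (restrict n f) ≤
      sjNorm hbar (window hbar q (n + k)) (restrict (n + k) f) := by
  induction k with
  | zero => exact ⟨hf, le_rfl⟩
  | succ k ih =>
    obtain ⟨h1, h2⟩ := restrict_mem_of_succ hbar_pos q_pos hf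
    exact ⟨(ih h1).1, (ih h1).2.trans h2⟩

lemma restrict_extend_of_le (hbar_pos : 0 < hbar) (q_pos : ∀ j, 0 < q j) {F : Rn m → ℂ}
    (hF : F ∈ sjostrand hbar m) (h : m ≤ n) :
    restrict n (extend F) ∈ sjostrand hbar n ∧
      sjNorm hbar (window hbar q n) (restrict n (extend F)) ≤ sjNorm hbar (window hbar q m) F ∧
      Ln hbar (restrict n (extend F)) = Ln hbar F := by
  induction n, h using Nat.le_induction with
  | base => rw [restrict_extend_self]; exact ⟨hF, le_rfl, rfl⟩
  | succ n h ih =>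
    have e : restrict (n + 1) (extend F) = fun z => restrict n (extend F) (init z) :=
      funext fun z => restrict_extend_succ F h z
    obtain ⟨h1, h2, h3⟩ := ih
    obtain ⟨hc, ⟨B, hB⟩, -⟩ := (mem_sjostrand_iff hbar_pos q_pos).1 h1
    rw [e]
    exact ⟨comp_init_mem_sjostrand hbar_pos q_pos h1,
      (sjNorm_comp_init_le hbar_pos q_pos hc hB).trans h2,
      (Ln_comp_init hbar_pos q_pos h1).trans h3⟩

/-- All restrictions of a cylinder function are controlled by its norm. -/
lemma restrict_extend_mem (hbar_pos : 0 < hbar) (q_pos : ∀ j, 0 < q j) {F : Rn m → ℂ}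
    (hF : F ∈ sjostrand hbar m) (n : ℕ) :
    restrict n (extend F) ∈ sjostrand hbar n ∧
      sjNorm hbar (window hbar q n) (restrict n (extend F)) ≤ sjNorm hbar (window hbar q m) F := by
  rcases le_total m n with h | h
  · obtain ⟨h1, h2, -⟩ := restrict_extend_of_le hbar_pos q_pos hF h
    exact ⟨h1, h2⟩
  · obtain ⟨k, rfl⟩ := Nat.exists_eq_add_of_le h
    have := restrict_mem_of_add (n := n) hbar_pos q_pos (f := extend F) k
      (by rwa [restrict_extend_self])
    rwa [restrict_extend_self] at this

/-- The given representation and the chosen one live in different dimensions. Both are lifted to the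
larger dimension, where they become the same restriction. -/
lemma Lmin_extend (hbar_pos : 0 < hbar) (q_pos : ∀ j, 0 < q j) {F : Rn m → ℂ}
    (hF : F ∈ sjostrand hbar m) : Lmin hbar (extend F) = Ln hbar F := by
  have h : ∃ p : (n : ℕ) × (Rn n → ℂ), p.2 ∈ sjostrand hbar p.1 ∧ extend F = extend p.2 :=
    ⟨⟨m, F⟩, hF, rfl⟩
  rw [Lmin, dif_pos h]
  obtain ⟨h1, h2⟩ := h.choose_spec
  rw [← (restrict_extend_of_le hbar_pos q_pos h1 (le_max_right m _)).2.2,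
    ← (restrict_extend_of_le hbar_pos q_pos hF (le_max_left m h.choose.1)).2.2, ← h2]

lemma eventually_Ln_restrict_eq (hbar_pos : 0 < hbar) (q_pos : ∀ j, 0 < q j) {f : RInf → ℂ}
    (hf : f ∈ cylinder hbar) : ∀ᶠ n in atTop, Ln hbar (restrict n f) = Lmin hbar f := by
  obtain ⟨m, F, hF, rfl⟩ := hf
  filter_upwards [eventually_ge_atTop m] with n hn
  rw [Lmin_extend hbar_pos q_pos hF]
  exact (restrict_extend_of_le hbar_pos q_pos hF hn).2.2

lemma restrict_mem_of_cylinder (hbar_pos : 0 < hbar) (q_pos : ∀ j, 0 < q j) {f : RInf → ℂ}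
    (hf : f ∈ cylinder hbar) (n : ℕ) : restrict n f ∈ sjostrand hbar n := by
  obtain ⟨m, F, hF, rfl⟩ := hf
  exact (restrict_extend_mem hbar_pos q_pos hF n).1

/-- The strict inequality yields one representation of norm below ε, which suffices: independence of
the norm from the representation is not needed. -/
lemma bounds_of_cylNorm_lt (hbar_pos : 0 < hbar) (q_pos : ∀ j, 0 < q j) {f : RInf → ℂ}
    {ε : ℝ≥0∞} (h : cylNorm hbar q f < ε) :
    (∀ x, ‖f x‖ₑ ≤ ε) ∧ ∀ n, sjNorm hbar (window hbar q n) (restrict n f) ≤ ε := by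
  simp only [cylNorm, iInf_lt_iff] at h
  obtain ⟨m, F, ⟨hF, rfl⟩, hε⟩ := h
  obtain ⟨hc, ⟨B, hB⟩, -⟩ := (mem_sjostrand_iff hbar_pos q_pos).1 hF
  exact ⟨fun x => (enorm_le_sjNorm_window hbar_pos q_pos hc hB _).trans hε.le,
    fun n => (restrict_extend_mem hbar_pos q_pos hF n).2.trans hε.le⟩

/-- Cauchy sequences of cylinder functions converge pointwise. -/
lemma IsCauchyCyl.exists_represents (hbar_pos : 0 < hbar) (q_pos : ∀ j, 0 < q j)
    {c : ℕ → RInf → ℂ} (hc : IsCauchyCyl hbar q c) : ∃ f, Represents hbar q c f := by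
  have h : ∀ x, ∃ a, Tendsto (fun j => c j x) atTop (𝓝 a) := by
    intro x
    refine cauchySeq_tendsto_of_complete (EMetric.cauchySeq_iff.2 fun ε hε => ?_)
    obtain ⟨δ, hδ, hδε⟩ := exists_between hε
    obtain ⟨N, hN⟩ := hc.2 δ hδ
    refine ⟨N, fun j hj k hk => ?_⟩
    rw [edist_eq_enorm_sub]
    exact ((bounds_of_cylNorm_lt hbar_pos q_pos (hN j hj k hk)).1 x).trans_lt hδε
  choose f hf using h
  exact ⟨f, hc, hf⟩

variable {c : ℕ → RInf → ℂ} {f : RInf → ℂ}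

lemma Represents.enorm_sub_le (hbar_pos : 0 < hbar) (q_pos : ∀ j, 0 < q j)
    (hf : Represents hbar q c f) {ε : ℝ≥0∞} {N : ℕ}
    (hN : ∀ j ≥ N, ∀ k ≥ N, cylNorm hbar q (c j - c k) < ε) {j : ℕ} (hj : N ≤ j) (x : RInf) :
    ‖c j x - f x‖ₑ ≤ ε := by
  refine le_of_tendsto ((tendsto_const_nhds (x := c j x)).sub (hf.2 x)).enorm ?_
  filter_upwards [eventually_ge_atTop N] with k hk
  exact (bounds_of_cylNorm_lt hbar_pos q_pos (hN j hj k hk)).1 x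

lemma Represents.continuous_restrict (hbar_pos : 0 < hbar) (q_pos : ∀ j, 0 < q j)
    (hf : Represents hbar q c f) (n : ℕ) : Continuous (restrict n f) := by
  have hu : TendstoUniformly (fun j => restrict n (c j)) (restrict n f) atTop := by
    rw [EMetric.tendstoUniformly_iff]
    intro ε hε
    obtain ⟨δ, hδ, hδε⟩ := exists_between hε
    obtain ⟨N, hN⟩ := hf.1.2 δ hδ
    filter_upwards [eventually_ge_atTop N] with j hj x
    rw [edist_comm, edist_eq_enorm_sub]
    exact (hf.enorm_sub_le hbar_pos q_pos hN hj _).trans_lt hδε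
  exact hu.continuous (Frequently.of_forall fun j =>
    (restrict_mem_of_cylinder hbar_pos q_pos (hf.1.1 j) n).1)

lemma Represents.exists_norm_restrict_le (hbar_pos : 0 < hbar) (q_pos : ∀ j, 0 < q j)
    (hf : Represents hbar q c f) (n : ℕ) : ∃ B, ∀ x, ‖restrict n f x‖ ≤ B := by
  obtain ⟨N, hN⟩ := hf.1.2 1 one_pos
  obtain ⟨-, ⟨B, hB⟩, -⟩ := (mem_sjostrand_iff hbar_pos q_pos).1
    (restrict_mem_of_cylinder hbar_pos q_pos (hf.1.1 N) n)
  refine ⟨B + 1, fun x => ?_⟩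
  have h1 : ‖restrict n (c N) x - restrict n f x‖ ≤ 1 := by
    have := ENNReal.toReal_mono ENNReal.one_ne_top
      (hf.enorm_sub_le hbar_pos q_pos hN le_rfl (fun j => if h : j < n then x ⟨j, h⟩ else 0))
    rwa [toReal_enorm, ENNReal.toReal_one] at this
  calc ‖restrict n f x‖ = ‖restrict n (c N) x - (restrict n (c N) x - restrict n f x)‖ := by
        rw [sub_sub_cancel]
    _ ≤ _ := (norm_sub_le _ _).trans (add_le_add (hB x) h1)

/-- Let k → ∞ in the Cauchy estimate, by lower semicontinuity of the norm. Essential is that `N` and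
ε do not depend on the dimension `n`. -/
lemma Represents.sjNorm_sub_le (hbar_pos : 0 < hbar) (q_pos : ∀ j, 0 < q j)
    (hf : Represents hbar q c f) {ε : ℝ≥0∞} (hε : ε ≠ ∞) {N : ℕ}
    (hN : ∀ j ≥ N, ∀ k ≥ N, cylNorm hbar q (c j - c k) < ε) {j : ℕ} (hj : N ≤ j) (n : ℕ) :
    sjNorm hbar (window hbar q n) (restrict n (c j) - restrict n f) ≤ ε := by
  have hb := fun k : ℕ => bounds_of_cylNorm_lt hbar_pos q_pos (hN j hj (k + N) (by omega))
  refine sjNorm_le_of_tendsto hbar_pos q_pos (Φ := fun k => restrict n (c j - c (k + N)))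
    (B := ε.toReal) (fun k => ?_) (fun k x => ?_) (fun x => ?_) fun k => (hb k).2 n
  · rw [restrict_sub]
    exact (restrict_mem_of_cylinder hbar_pos q_pos (hf.1.1 _) n).1.sub
      (restrict_mem_of_cylinder hbar_pos q_pos (hf.1.1 _) n).1
  · rw [← toReal_enorm]
    exact ENNReal.toReal_mono hε ((hb k).1 _)
  · exact tendsto_const_nhds.sub ((tendsto_add_atTop_iff_nat N).2 (hf.2 _))

lemma Represents.restrict_mem (hbar_pos : 0 < hbar) (q_pos : ∀ j, 0 < q j)
    (hf : Represents hbar q c f) (n : ℕ) : restrict n f ∈ sjostrand hbar n := by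
  obtain ⟨N, hN⟩ := hf.1.2 1 one_pos
  have hfc := hf.continuous_restrict hbar_pos q_pos n
  obtain ⟨B', hB'⟩ := hf.exists_norm_restrict_le hbar_pos q_pos n
  have hcN := restrict_mem_of_cylinder hbar_pos q_pos (hf.1.1 N) n
  obtain ⟨hc, ⟨B, hB⟩, -⟩ := (mem_sjostrand_iff hbar_pos q_pos).1 hcN
  have hd : restrict n (c N) - restrict n f ∈ sjostrand hbar n :=
    (mem_sjostrand_iff hbar_pos q_pos).2 ⟨hc.sub hfc,
      ⟨B + B', fun x => (norm_sub_le _ _).trans (add_le_add (hB x) (hB' x))⟩,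
      (hf.sjNorm_sub_le hbar_pos q_pos ENNReal.one_ne_top hN le_rfl n).trans_lt
        ENNReal.one_lt_top⟩
  -- The restriction of `f` is that of c_N minus the difference just bounded.
  simpa using sub_mem_sjostrand hbar_pos q_pos hcN hd

/-- The Fresnel integrals of the restrictions of `c_j` converge uniformly in the dimension. -/
lemma Represents.exists_norm_Ln_sub_lt (hbar_pos : 0 < hbar) (q_pos : ∀ j, 0 < q j)
    (q_sum : Summable fun j => q j ^ 2) (hf : Represents hbar q c f) {δ : ℝ} (hδ : 0 < δ) :
    ∃ N, ∀ j ≥ N, ∀ n, ‖Ln hbar (restrict n (c j)) - Ln hbar (restrict n f)‖ ≤ δ := by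
  set C := Real.exp (∑' j, q j ^ 2) with hC
  have hCpos : 0 < C := Real.exp_pos _
  obtain ⟨N, hN⟩ := hf.1.2 (ENNReal.ofReal (δ / C)) (by simpa using div_pos hδ hCpos)
  refine ⟨N, fun j hj n => ?_⟩
  have h1 := restrict_mem_of_cylinder hbar_pos q_pos (hf.1.1 j) n
  have h2 := hf.restrict_mem hbar_pos q_pos n
  rw [← Ln_sub hbar_pos q_pos h1 h2]
  have h3 := (enorm_Ln_le hbar_pos q_pos q_sum (sub_mem_sjostrand hbar_pos q_pos h1 h2)).trans
    (mul_le_mul_right (hf.sjNorm_sub_le hbar_pos q_pos ENNReal.ofReal_ne_top hN hj n) _)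
  rw [← ENNReal.ofReal_mul hCpos.le, mul_div_cancel₀ _ hCpos.ne', ← ofReal_norm] at h3
  exact (ENNReal.ofReal_le_ofReal_iff hδ.le).1 h3

/-- Interchange of limits for the double sequence L_n(c_j^{(n)}): convergence in j is uniform in n,
and for each j the sequence in n is eventually constant. -/
lemma Represents.exists_tendsto (hbar_pos : 0 < hbar) (q_pos : ∀ j, 0 < q j)
    (q_sum : Summable fun j => q j ^ 2) (hf : Represents hbar q c f) :
    ∃ a, Tendsto (fun j => Lmin hbar (c j)) atTop (𝓝 a) ∧
      Tendsto (fun n => Ln hbar (restrict n f)) atTop (𝓝 a) := by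
  have hcauchy : CauchySeq fun j => Lmin hbar (c j) := by
    rw [Metric.cauchySeq_iff]
    intro δ hδ
    obtain ⟨N, hN⟩ := hf.exists_norm_Ln_sub_lt hbar_pos q_pos q_sum (by positivity : 0 < δ / 3)
    refine ⟨N, fun j hj k hk => ?_⟩
    -- In a dimension so large that both functionals have stabilized, both values are compared with
    -- the same number L_n(f^{(n)}).
    obtain ⟨n, hnj, hnk⟩ := ((eventually_Ln_restrict_eq hbar_pos q_pos (hf.1.1 j)).and
      (eventually_Ln_restrict_eq hbar_pos q_pos (hf.1.1 k))).exists
    have h1 := hN j hj n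
    have h2 := hN k hk n
    rw [hnj, ← dist_eq_norm] at h1
    rw [hnk, ← dist_eq_norm] at h2
    linarith [dist_triangle_right (Lmin hbar (c j)) (Lmin hbar (c k)) (Ln hbar (restrict n f))]
  obtain ⟨a, ha⟩ := cauchySeq_tendsto_of_complete hcauchy
  refine ⟨a, ha, Metric.tendsto_atTop'.2 fun δ hδ => ?_⟩
  obtain ⟨N, hN⟩ := hf.exists_norm_Ln_sub_lt hbar_pos q_pos q_sum (by positivity : 0 < δ / 3)
  obtain ⟨j, hj, hja⟩ := ((eventually_ge_atTop N).and
    (Metric.tendsto_nhds.1 ha (δ / 3) (by positivity))).exists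
  obtain ⟨M, hM⟩ := eventually_atTop.1 (eventually_Ln_restrict_eq hbar_pos q_pos (hf.1.1 j))
  refine ⟨M, fun n hn => ?_⟩
  have h1 := hN j hj n
  rw [hM n hn.le, ← dist_eq_norm] at h1
  linarith [dist_triangle_left (Ln hbar (restrict n f)) a (Lmin hbar (c j))]

end Cylinder

end Fresnel

end

theorem theorem6p1 (hbar : ℝ) (hbar_pos : 0 < hbar) (hbar_le : hbar ≤ 1)
    (q : ℕ → ℝ) (q_pos : ∀ j, 0 < q j) (q_sum : Summable (fun j => q j ^ 2)) :
    -- every Cauchy sequence of cylinder functions represents a function on `ℝ^∞`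
    (∀ c, Fresnel.IsCauchyCyl hbar q c → ∃ f, Fresnel.Represents hbar q c f) ∧
    -- `L'` extends `L`
    ∀ f ∈ Fresnel.domL hbar q,
      f ∈ Fresnel.domL' hbar ∧ Fresnel.L' hbar f = Fresnel.L hbar q f ∧
      -- the values involved are genuine Fresnel integrals and limits
      (∀ n, Fresnel.HasFresnelIntegral hbar (Fresnel.restrict n f)
        (Fresnel.Ln hbar (Fresnel.restrict n f))) ∧
      ∀ c, Fresnel.Represents hbar q c f →
        Tendsto (fun j => Fresnel.Lmin hbar (c j)) atTop (𝓝 (Fresnel.L hbar q f)) := by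
  refine ⟨fun c hc => hc.exists_represents hbar_pos q_pos, fun f hf => ?_⟩
  have hrep : ∃ c, Fresnel.Represents hbar q c f := hf
  obtain ⟨a, ha, ha'⟩ := hrep.choose_spec.exists_tendsto hbar_pos q_pos q_sum
  have hL : Fresnel.L hbar q f = a := by
    rw [Fresnel.L, dif_pos hrep]
    exact ha.limUnder_eq
  have hmem := hrep.choose_spec.restrict_mem hbar_pos q_pos
  refine ⟨⟨hmem, a, ha'⟩, ?_, fun n => Fresnel.hasFresnelIntegral_Ln hbar_pos q_pos (hmem n), ?_⟩
  · rw [hL]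
    exact ha'.limUnder_eq
  · intro c hc
    -- The limit along any representing sequence equals lim L_n(f^{(n)}), which depends only on `f`;
    -- so L does not depend on the chosen sequence.
    obtain ⟨b, hb, hb'⟩ := hc.exists_tendsto hbar_pos q_pos q_sum
    rwa [hL, tendsto_nhds_unique ha' hb']
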